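/- **Theorem 1.2.** A permutation is a sequence $\sigma=a_1a_2\dots a_n$ of elements of $[n]=\{1,\dots,n\}$ in which every element of $[n]$ appears precisely once; let $S$ be the set of all permutations. For a finite sequence $s$ of distinct numbers, $\mathrm{perm}(s)$ denotes the unique permutation of the same length as $s$ whose entries are in the same relative order as those of $s$. For $\sigma,\tau\in S$ write $\sigma\leq\tau$ (and say that $\sigma$ is a consecutive subpermutation of $\tau$) if $\sigma=\mathrm{perm}(s)$ for some block $s$ of consecutive entries of $\tau$; this is a partial order on $S$. For $\beta_1,\dots,\beta_n\in S$ let $$\mathrm{Av}(\beta_1,\dots,\beta_n)=\{\sigma\in S : \beta_i\not\leq\sigma \text{ for all } i=1,\dots,n\}.$$ A downward closed set $C\subseteq S$ is *atomic* if it is not the union of two downward closed proper subsets of $C$; it is *well quasi-ordered* if it is well-founded (contains no infinite strictly decreasing sequence) and contains no infinite antichain. It is algorithmically decidable, given a finite set of permutations $\beta_1,\dots,\beta_n$, whether the set $\mathrm{Av}(\beta_1,\dots,\beta_n)$ is 1. atomic; 2. well quasi-ordered. That is, for each of the two properties there is a single algorithm which, given any finite list $\beta_1,\dots,\beta_n$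 of permutations, halts and correctly answers whether $\mathrm{Av}(\beta_1,\dots,\beta_n)$ has the property. -/

import Mathlib

namespace ConsecPerm

section Poset

variable {α : Type*} [PartialOrder α]

/-- The avoidance set `Av(B) = {a : b ≰ a for all b ∈ B}`. -/
def Av (B : Set α) : Set α := {a | ∀ b ∈ B, ¬ b ≤ a}

/-- A downward closed set `C` is atomic if it cannot be decomposed as a union of two
downward closed proper subsets. -/
def Atomic (C : Set α) : Prop :=
  ¬ ∃ D E : Set α, IsLowerSet D ∧ IsLowerSet E ∧ D ⊂ C ∧ E ⊂ C ∧ C = D ∪ E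

/-- A set `C` (with the induced order) is well quasi-ordered if it is well-founded and has
no infinite antichains. -/
def WQO (C : Set α) : Prop :=
  C.WellFoundedOn (· < ·) ∧ ∀ A : Set α, A ⊆ C → IsAntichain (· ≤ ·) A → A.Finite

end Poset

/-- `l = a₁a₂…aₙ` is a sequence of elements of `{1, …, n}`, with `n` its length, in which every
element of `{1, …, n}` appears precisely once. -/
def IsPermutation (l : List ℕ) : Prop :=
  (∀ a ∈ l, 1 ≤ a ∧ a ≤ l.length) ∧ ∀ k, 1 ≤ k → k ≤ l.length → l.count k = 1

/-- The set `S` of all permutations (in one-line notation). -/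
def Permutation : Type := {l : List ℕ // IsPermutation l}

/-- `IsPermOf σ s` says that `σ = perm(s)`: the sequences have the same length and
their entries are in the same relative order. -/
def IsPermOf (σ : Permutation) (s : List ℕ) : Prop :=
  s.length = σ.1.length ∧
    ∀ i j, i < s.length → j < s.length → (s.getD i 0 ≤ s.getD j 0 ↔ σ.1.getD i 0 ≤ σ.1.getD j 0)

theorem IsPermutation.nodup {l : List ℕ} (h : IsPermutation l) : l.Nodup := by
  rw [List.nodup_iff_count_le_one]
  intro a
  by_cases ha : a ∈ l
  · exact (h.2 a (h.1 a ha).1 (h.1 a ha).2).le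
  · simp [List.count_eq_zero_of_not_mem ha]

theorem IsPermutation.perm_range' {l : List ℕ} (h : IsPermutation l) :
    l.Perm (List.range' 1 l.length) := by
  rw [List.perm_ext_iff_of_nodup h.nodup List.nodup_range']
  intro a
  rw [List.mem_range'_1]
  constructor
  · intro ha
    have := h.1 a ha
    omega
  · intro ha
    have := h.2 a (by omega) (by omega)
    exact List.count_pos_iff.1 (by omega)

/-- An entry of a permutation is the number of entries that do not exceed it. -/
theorem IsPermutation.card_le {l : List ℕ} (h : IsPermutation l) {i : ℕ} (hi : i < l.length) :
    ((Finset.range l.length).filter fun j => l.getD j 0 ≤ l.getD i 0).card = l.getD i 0 := by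
  have hmem : ∀ j, j < l.length → l.getD j 0 ∈ l := by
    intro j hj
    rw [List.getD_eq_getElem _ _ hj]
    exact List.getElem_mem hj
  have himg : ((Finset.range l.length).filter fun j => l.getD j 0 ≤ l.getD i 0).image
      (fun j => l.getD j 0) = Finset.Icc 1 (l.getD i 0) := by
    ext a
    simp only [Finset.mem_image, Finset.mem_filter, Finset.mem_range, Finset.mem_Icc]
    constructor
    · rintro ⟨j, ⟨hj, hle⟩, rfl⟩
      exact ⟨(h.1 _ (hmem j hj)).1, hle⟩
    · rintro ⟨h1, h2⟩
      have ha : a ∈ l := by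
        have := h.2 a h1 (h2.trans (h.1 _ (hmem i hi)).2)
        exact List.count_pos_iff.1 (by omega)
      obtain ⟨j, hj, rfl⟩ := List.mem_iff_getElem.1 ha
      exact ⟨j, ⟨hj, by rwa [List.getD_eq_getElem _ _ hj]⟩, List.getD_eq_getElem _ _ hj⟩
  have hinj : Set.InjOn (fun j => l.getD j 0)
      ((Finset.range l.length).filter fun j => l.getD j 0 ≤ l.getD i 0 : Finset ℕ) := by
    intro a ha b hb hab
    simp only [Finset.coe_filter, Finset.mem_range, Set.mem_ofPred_eq] at ha hb
    simp only [List.getD_eq_getElem _ _ ha.1, List.getD_eq_getElem _ _ hb.1] at hab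
    exact (h.nodup.getElem_inj_iff).1 hab
  rw [← Finset.card_image_of_injOn hinj, himg]
  simp

/-- `perm(s)` is unique. -/
theorem IsPermOf.unique {σ τ : Permutation} {s : List ℕ} (hσ : IsPermOf σ s)
    (hτ : IsPermOf τ s) : σ = τ := by
  apply Subtype.ext
  have hlen : σ.1.length = τ.1.length := hσ.1.symm.trans hτ.1
  refine List.ext_getElem hlen fun i h1 h2 => ?_
  rw [← List.getD_eq_getElem _ 0 h1, ← List.getD_eq_getElem _ 0 h2, ← σ.2.card_le h1,
    ← τ.2.card_le h2, hlen]
  congr 1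
  apply Finset.filter_congr
  intro j hj
  rw [Finset.mem_range] at hj
  rw [← hσ.2 j i (by rw [hτ.1]; exact hj) (by rw [hσ.1]; exact h1),
    hτ.2 j i (by rw [hτ.1]; exact hj) (by rw [hσ.1]; exact h1)]

theorem isPermOf_self (σ : Permutation) : IsPermOf σ σ.1 := ⟨rfl, fun _ _ _ _ => Iff.rfl⟩

/-- The consecutive subpermutation ordering: `σ ≤ τ` if `σ = perm(s)` for a block `s` of
consecutive entries of `τ`. -/
instance : PartialOrder Permutation where
  le σ τ := ∃ s : List ℕ, s <:+: τ.1 ∧ IsPermOf σ s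
  le_refl σ := ⟨σ.1, List.infix_rfl, isPermOf_self σ⟩
  le_trans := by
    rintro σ τ ρ ⟨s, ⟨u, v, huv⟩, hs⟩ ⟨t, ht, hτ⟩
    have hl : t.length = u.length + s.length + v.length := by
      rw [hτ.1, ← huv]; simp [add_assoc]
    refine ⟨(t.drop u.length).take s.length,
      ((List.take_prefix _ _).isInfix.trans (List.drop_suffix _ _).isInfix).trans ht, ?_, ?_⟩
    · rw [← hs.1]
      simp only [List.length_take, List.length_drop]
      omega
    · intro i j hi hj
      have hi' : i < s.length := lt_of_lt_of_le hi (by simp)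
      have hj' : j < s.length := lt_of_lt_of_le hj (by simp)
      have key : ∀ k, k < s.length →
          ((t.drop u.length).take s.length).getD k 0 = t.getD (u.length + k) 0 ∧
          τ.1.getD (u.length + k) 0 = s.getD k 0 := by
        intro k hk
        constructor
        · simp [List.getD_eq_getElem?_getD, hk]
        · rw [← huv]
          simp [List.getD_eq_getElem?_getD, List.getElem?_append, hk]
      rw [(key i hi').1, (key j hj').1, hτ.2 _ _ (by omega) (by omega), (key i hi').2,
        (key j hj').2, hs.2 i j hi' hj']
  le_antisymm := by
    rintro σ τ ⟨s, hs, hσ⟩ ⟨t, ht, hτ⟩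
    have h1 := hs.length_le
    have h2 := ht.length_le
    have := hσ.1
    have := hτ.1
    have : s = τ.1 := hs.eq_of_length (by omega)
    subst this
    exact hσ.unique (isPermOf_self τ)

theorem isPermutation_primrec : PrimrecPred IsPermutation := by
  have hmem : PrimrecRel fun (l : List ℕ) (k : ℕ) => ∃ a ∈ l, a = k + 1 :=
    PrimrecRel.exists_mem_list (R := fun (a k : ℕ) => a = k + 1)
      (Primrec.eq.comp Primrec.fst (Primrec.succ.comp Primrec.snd))
  have hall : PrimrecRel fun (L : List ℕ) (l : List ℕ) => ∀ k ∈ L, ∃ a ∈ l, a = k + 1 :=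
    PrimrecRel.forall_mem_list (R := fun (k : ℕ) (l : List ℕ) => ∃ a ∈ l, a = k + 1)
      (hmem.comp Primrec.snd Primrec.fst)
  refine (hall.comp (Primrec.list_range.comp Primrec.list_length) Primrec.id).of_eq fun l => ?_
  simp only [List.mem_range, id]
  constructor
  · intro h
    have hsub : List.range' 1 l.length ⊆ l := by
      intro a ha
      rw [List.mem_range'_1] at ha
      obtain ⟨b, hb, rfl⟩ := h (a - 1) (by omega)
      rwa [show a - 1 + 1 = a by omega] at hb
    have hperm : (List.range' 1 l.length).Perm l :=
      (List.subperm_of_subset List.nodup_range' hsub).perm_of_length_le (by simp)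
    constructor
    · intro a ha
      have := hperm.mem_iff.2 ha
      rw [List.mem_range'_1] at this
      omega
    · intro k h1 h2
      rw [← hperm.count_eq]
      exact List.count_eq_one_of_mem List.nodup_range' (by rw [List.mem_range'_1]; omega)
  · intro h k hk
    have := h.2 (k + 1) (by omega) (by omega)
    exact ⟨k + 1, List.count_pos_iff.1 (by omega), rfl⟩

/-- Permutations are presented to an algorithm as the lists of their entries. -/
noncomputable instance : Primcodable Permutation :=
  haveI : DecidablePred IsPermutation := Classical.decPred _
  Primcodable.subtype isPermutation_primrec

end ConsecPerm

/-!
A permutation is treated as a finite sequence `f 0, …, f (n - 1)` of distinct rationals up to order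
isomorphism. The avoidance set of `B` becomes a class `C` of such sequences that is closed under
blocks and is local (`IsLocalClass`): once `b` exceeds the lengths of the forbidden permutations, a
sequence of length at least `b` belongs to `C` if and only if all its windows of `b` consecutive
entries do. Two linear orders that agree on the intersection of their domains have a common
extension (`amalgam`). Hence two members of `C` that overlap in at least `b` positions can be glued
(`IsLocalClass.splice`), so that the members of `C` are walks in a finite graph of windows, together
with choices for the order of entries that are far apart. If one remembers in addition the position
of the window relative to two marked entries, walks can be cut or repeated between equal states with
the order of the marked entries kept (`IsLocalClass.splice_marked`). Both properties are thereby
reduced to the members of `C` of bounded length, which can be searched.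

*Well quasi-order.* There are two sources of infinite antichains. One is a stretch of windows with a
period that breaks at both of its ends (`IsolatedPeriod`): it can be pumped, and its two ends
prevent embeddings between stretches of different lengths. The other is a pair of members with the
same windows of length `b` that order their first and last entries differently, where these are
far apart (`SplitPair`). Pumping such a pair gives an eventually periodic infinite sequence, or one
whose reversal is eventually periodic, in which the order of an entry relative to infinitely many
others is left undetermined by the windows. These free choices produce an infinite antichain
(`HasAntichain.of_eventually_periodic`): either two distant choices are made against a uniform
default, and serve as end markers, or the first entry is moved to just beside the last one.
Both kinds of obstruction can be cut down to bounded length. If there are none, long members are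
determined by their windows of length `m`, and the sequence of these windows is periodic, has a
centre of bounded length, and is periodic again. Dickson's lemma, applied to the lengths of the two
periodic parts, shows that there is no infinite antichain (`exists_embeds`).

*Atomicity.* A downward closed set is atomic if and only if any two of its elements have a common
upper bound in it (`atomic_iff`). If windows have common extensions, then of the first windows of
two members `x` and `y` one can be reached from the other, say that of `y` from that of `x`. If `x`
and `y` have no common extension, extend `y` to the left by a walk that starts with the first window
of `x`, and compare the positions at which the two sequences leave the set of windows from which one
can return to this window. A common extension has to align these positions, so the sequences must
differ once they are aligned (`Clash`). Conversely a clash excludes a common extension, and it can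
be cut down to bounded length with one pair of entries in which the sequences differ kept. Thus it
suffices to test pairs of bounded length (`joins_of_short`), and common extensions can be taken of
bounded length as well (`Joins.exists_short`).

All these bounded searches are primitive recursive.
-/

namespace ConsecPerm

/-! ### Finite sequences of rationals up to order isomorphism -/

/-- `f` and `g` have the same relative order on the positions `0, …, n - 1`. -/
def SameOrder (f g : ℕ → ℚ) (n : ℕ) : Prop :=
  ∀ i < n, ∀ j < n, (f i < f j ↔ g i < g j)

/-- The sequence `f` read from position `o` on. -/
def shift (o : ℕ) (f : ℕ → ℚ) : ℕ → ℚ := fun i => f (o + i)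

/-- The first `n` terms of `f` are order isomorphic to a block of the first `k` terms of `g`. -/
def Embeds (f : ℕ → ℚ) (n : ℕ) (g : ℕ → ℚ) (k : ℕ) : Prop :=
  ∃ o, o + n ≤ k ∧ SameOrder f (shift o g) n

/-- On the first `n` positions, `f` and `g` order any two positions at distance less than `b`
in the same way. -/
def SameLocal (b : ℕ) (f g : ℕ → ℚ) (n : ℕ) : Prop :=
  ∀ i < n, ∀ j < n, i < j + b → j < i + b → (f i < f j ↔ g i < g j)

/-- The first `n` terms of `f` are distinct. -/
def Inj (f : ℕ → ℚ) (n : ℕ) : Prop := ∀ i < n, ∀ j < n, f i = f j → i = j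

@[simp] theorem shift_apply (o i : ℕ) (f : ℕ → ℚ) : shift o f i = f (o + i) := rfl

@[simp] theorem shift_shift (o p : ℕ) (f : ℕ → ℚ) : shift o (shift p f) = shift (p + o) f := by
  funext i; simp [add_assoc]

@[simp] theorem shift_zero (f : ℕ → ℚ) : shift 0 f = f := by
  funext i; simp

namespace SameOrder

variable {f g h : ℕ → ℚ} {n k : ℕ}

theorem refl (f : ℕ → ℚ) (n : ℕ) : SameOrder f f n := fun _ _ _ _ => Iff.rfl

theorem symm (h : SameOrder f g n) : SameOrder g f n := fun i hi j hj => (h i hi j hj).symm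

theorem trans (h₁ : SameOrder f g n) (h₂ : SameOrder g h n) : SameOrder f h n :=
  fun i hi j hj => (h₁ i hi j hj).trans (h₂ i hi j hj)

theorem mono (h : SameOrder f g n) (hk : k ≤ n) : SameOrder f g k :=
  fun i hi j hj => h i (by omega) j (by omega)

theorem shift {o : ℕ} (h : SameOrder f g n) (hk : o + k ≤ n) :
    SameOrder (shift o f) (shift o g) k :=
  fun i hi j hj => h (o + i) (by omega) (o + j) (by omega)

theorem inj (h : SameOrder f g n) (hf : Inj f n) : Inj g n := by
  intro i hi j hj hij
  by_contra hne
  rcases lt_or_gt_of_ne (fun e => hne (hf i hi j hj e)) with hlt | hlt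
  · have := (h i hi j hj).1 hlt
    exact absurd hij this.ne
  · have := (h j hj i hi).1 hlt
    exact absurd hij this.ne'

theorem sameLocal (h : SameOrder f g n) (b : ℕ) : SameLocal b f g n :=
  fun i hi j hj _ _ => h i hi j hj

end SameOrder

theorem Inj.shift {f : ℕ → ℚ} {n o k : ℕ} (h : Inj f n) (hk : o + k ≤ n) : Inj (shift o f) k := by
  intro i hi j hj hij
  have := h (o + i) (by omega) (o + j) (by omega) hij
  omega

theorem Inj.mono {f : ℕ → ℚ} {n k : ℕ} (h : Inj f n) (hk : k ≤ n) : Inj f k :=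
  fun i hi j hj hij => h i (by omega) j (by omega) hij

namespace Embeds

variable {f g h : ℕ → ℚ} {n k l : ℕ}

theorem refl (f : ℕ → ℚ) (n : ℕ) : Embeds f n f n := ⟨0, by simp, by simpa using SameOrder.refl f n⟩

theorem trans (h₁ : Embeds f n g k) (h₂ : Embeds g k h l) : Embeds f n h l := by
  obtain ⟨o, ho, hfg⟩ := h₁
  obtain ⟨p, hp, hgh⟩ := h₂
  refine ⟨p + o, by omega, ?_⟩
  have := hgh.shift (o := o) (k := n) ho
  rw [shift_shift] at this
  exact hfg.trans this

theorem block {f : ℕ → ℚ} {n o k : ℕ} (h : o + k ≤ n) : Embeds (shift o f) k f n :=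
  ⟨o, h, SameOrder.refl _ _⟩

end Embeds

namespace SameLocal

variable {b : ℕ} {f g h : ℕ → ℚ} {n k : ℕ}

theorem refl (b : ℕ) (f : ℕ → ℚ) (n : ℕ) : SameLocal b f f n := fun _ _ _ _ _ _ => Iff.rfl

theorem symm (h : SameLocal b f g n) : SameLocal b g f n :=
  fun i hi j hj h₁ h₂ => (h i hi j hj h₁ h₂).symm

theorem trans (h₁ : SameLocal b f g n) (h₂ : SameLocal b g h n) : SameLocal b f h n :=
  fun i hi j hj hij hji => (h₁ i hi j hj hij hji).trans (h₂ i hi j hj hij hji)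

theorem mono (h : SameLocal b f g n) (hk : k ≤ n) : SameLocal b f g k :=
  fun i hi j hj => h i (by omega) j (by omega)

theorem shift {o : ℕ} (h : SameLocal b f g n) (hk : o + k ≤ n) :
    SameLocal b (shift o f) (shift o g) k :=
  fun i hi j hj h₁ h₂ => h (o + i) (by omega) (o + j) (by omega) (by omega) (by omega)

theorem window {o : ℕ} (h : SameLocal b f g n) (hk : o + b ≤ n) :
    SameOrder (ConsecPerm.shift o f) (ConsecPerm.shift o g) b :=
  fun i hi j hj => h (o + i) (by omega) (o + j) (by omega) (by omega) (by omega)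

theorem of_windows (h : ∀ o, o + b ≤ n →
    SameOrder (ConsecPerm.shift o f) (ConsecPerm.shift o g) b) (hn : b ≤ n) :
    SameLocal b f g n := by
  intro i hi j hj hij hji
  obtain ⟨o, ho, h₁, h₂, h₃, h₄⟩ : ∃ o, o + b ≤ n ∧ o ≤ i ∧ o ≤ j ∧ i < o + b ∧ j < o + b :=
    ⟨min (min i j) (n - b), by omega, by omega, by omega, by omega, by omega⟩
  have := h o ho (i - o) (by omega) (j - o) (by omega)
  simpa [show o + (i - o) = i by omega, show o + (j - o) = j by omega] using this

end SameLocal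

/-! ### Amalgamation of finite linear orders -/

/-- A new value can be put directly below a finite set `U` of values, that is, above everything
in the finite set `X` that lies below `U`. -/
theorem exists_value_below (X U : Finset ℚ) :
    ∃ v : ℚ, (∀ u ∈ U, v < u) ∧ ∀ x ∈ X, (∀ u ∈ U, x < u) → x < v := by
  obtain ⟨v, h₁, h₂⟩ := Order.exists_between_finsets (X.filter fun x => ∀ u ∈ U, x < u) U
    (by
      intro x hx u hu
      exact (Finset.mem_filter.1 hx).2 u hu)
  exact ⟨v, h₂, fun x hx h => h₁ x (Finset.mem_filter.2 ⟨hx, h⟩)⟩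

/-- Two finite linear orders that agree on their intersection have a common extension. -/
theorem amalgam (X Y : Finset ℕ) (f g : ℕ → ℚ) (hf : Set.InjOn f X) (hg : Set.InjOn g Y)
    (hfg : ∀ i ∈ X, i ∈ Y → ∀ j ∈ X, j ∈ Y → (f i < f j ↔ g i < g j)) :
    ∃ h : ℕ → ℚ, Set.InjOn h (X ∪ Y : Finset ℕ) ∧ (∀ i ∈ X, h i = f i) ∧
      ∀ i ∈ Y, ∀ j ∈ Y, (h i < h j ↔ g i < g j) := by
  have key : ∀ Z : Finset ℕ, Z ⊆ Y \ X → ∃ h : ℕ → ℚ, Set.InjOn h (X ∪ Z : Finset ℕ) ∧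
      (∀ i ∈ X, h i = f i) ∧
      ∀ i ∈ X ∪ Z, i ∈ Y → ∀ j ∈ X ∪ Z, j ∈ Y → (h i < h j ↔ g i < g j) := by
    intro Z
    induction Z using Finset.induction_on with
    | empty =>
      intro _
      exact ⟨f, by simpa using hf, fun _ _ => rfl, by simpa using hfg⟩
    | insert z Z hz ih =>
      intro hsub
      obtain ⟨h, hinj, hX, hY⟩ := ih fun i hi => hsub (Finset.mem_insert_of_mem hi)
      have hzmem := hsub (Finset.mem_insert_self z Z)
      rw [Finset.mem_sdiff] at hzmem
      have hznot : z ∉ X ∪ Z := by simp [hz, hzmem.2]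
      obtain ⟨v, hv₁, hv₂⟩ := exists_value_below ((X ∪ Z).image h)
        (((X ∪ Z).filter fun i => i ∈ Y ∧ g z < g i).image h)
      have hup : ∀ i ∈ X ∪ Z, i ∈ Y → g z < g i → v < h i := fun i hi hiY hlt =>
        hv₁ _ (Finset.mem_image_of_mem _ (Finset.mem_filter.2 ⟨hi, hiY, hlt⟩))
      have hdn : ∀ i ∈ X ∪ Z, i ∈ Y → g i < g z → h i < v := by
        intro i hi hiY hlt
        refine hv₂ _ (Finset.mem_image_of_mem _ hi) ?_
        intro u hu
        obtain ⟨j, hj, rfl⟩ := Finset.mem_image.1 hu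
        rw [Finset.mem_filter] at hj
        exact (hY i hi hiY j hj.1 hj.2.1).2 (hlt.trans hj.2.2)
      have hne : ∀ i ∈ X ∪ Z, h i ≠ v := by
        intro i hi he
        by_cases hall : ∀ u ∈ (((X ∪ Z).filter fun i => i ∈ Y ∧ g z < g i).image h), h i < u
        · exact absurd he (hv₂ _ (Finset.mem_image_of_mem _ hi) hall).ne
        · push Not at hall
          obtain ⟨u, hu, hle⟩ := hall
          exact absurd he ((hv₁ u hu).trans_le hle).ne'
      have hupd : ∀ i ∈ X ∪ Z, Function.update h z v i = h i := by
        intro i hi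
        exact Function.update_of_ne (by rintro rfl; exact hznot hi) _ _
      have hmem : ∀ i, i ∈ X ∪ insert z Z ↔ i = z ∨ i ∈ X ∪ Z := by
        intro i; simp only [Finset.mem_union, Finset.mem_insert]; tauto
      refine ⟨Function.update h z v, ?_, ?_, ?_⟩
      · intro i hi j hj hij
        rw [Finset.mem_coe, hmem] at hi hj
        rcases hi with rfl | hi <;> rcases hj with rfl | hj
        · rfl
        · rw [Function.update_self, hupd j hj] at hij
          exact absurd hij.symm (hne j hj)
        · rw [Function.update_self, hupd i hi] at hij
          exact absurd hij (hne i hi)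
        · rw [hupd i hi, hupd j hj] at hij
          exact hinj hi hj hij
      · intro i hi
        rw [hupd i (Finset.mem_union_left _ hi), hX i hi]
      · intro i hi hiY j hj hjY
        rw [hmem] at hi hj
        have hgne : ∀ i ∈ X ∪ Z, i ∈ Y → g i ≠ g z := fun i hi hiY he =>
          hznot (hg hiY hzmem.1 he ▸ hi)
        rcases hi with rfl | hi <;> rcases hj with rfl | hj
        · simp
        · rw [Function.update_self, hupd j hj]
          refine ⟨fun hlt => ?_, hup j hj hjY⟩
          by_contra hnlt
          exact absurd (hdn j hj hjY (lt_of_le_of_ne (not_lt.1 hnlt) (hgne j hj hjY)))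
            (not_lt.2 hlt.le)
        · rw [Function.update_self, hupd i hi]
          refine ⟨fun hlt => ?_, hdn i hi hiY⟩
          by_contra hnlt
          exact absurd (hup i hi hiY (lt_of_le_of_ne (not_lt.1 hnlt) (hgne i hi hiY).symm))
            (not_lt.2 hlt.le)
        · rw [hupd i hi, hupd j hj]
          exact hY i hi hiY j hj hjY
  obtain ⟨h, hinj, hX, hY⟩ := key (Y \ X) (Finset.Subset.refl _)
  rw [Finset.union_sdiff_self_eq_union] at hinj hY
  exact ⟨h, hinj, hX, fun i hi j hj =>
    hY i (Finset.mem_union_right _ hi) hi j (Finset.mem_union_right _ hj) hj⟩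

/-- A sequence can be built term by term if every good initial part has a good extension. -/
theorem exists_seq {α : Type*} [Inhabited α] (Good : ℕ → (ℕ → α) → Prop)
    (hloc : ∀ n g g', (∀ i ≤ n, g i = g' i) → Good n g → Good n g')
    (hstep : ∀ n g, (∀ i < n, Good i g) → ∃ v, Good n (Function.update g n v)) :
    ∃ F, ∀ n, Good n F := by
  classical
  choose v hv using hstep
  let step : ℕ → (ℕ → α) → ℕ → α := fun n g =>
    if h : ∀ i < n, Good i g then Function.update g n (v n g h) else g
  let G : ℕ → ℕ → α := fun n => Nat.rec (fun _ => default) step n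
  have hG : ∀ n, G (n + 1) = step n (G n) := fun n => rfl
  have hgood : ∀ n, ∀ i < n, Good i (G n) := by
    intro n
    induction n with
    | zero => intro i hi; omega
    | succ n ih =>
      intro i hi
      rw [hG]
      simp only [step, dif_pos ih]
      rcases Nat.lt_succ_iff_lt_or_eq.1 hi with h | rfl
      · refine hloc i (G n) _ (fun j hj => ?_) (ih i h)
        rw [Function.update_of_ne (by omega)]
      · exact hv _ _ _
  have hstab : ∀ n i, i < n → G n i = G (i + 1) i := by
    intro n
    induction n with
    | zero => intro i hi; omega
    | succ n ih =>
      intro i hi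
      rcases Nat.lt_succ_iff_lt_or_eq.1 hi with h | rfl
      · rw [← ih i h, hG]
        simp only [step, dif_pos (hgood n)]
        rw [Function.update_of_ne (by omega)]
      · rfl
  refine ⟨fun n => G (n + 1) n, fun n => ?_⟩
  exact hloc n (G (n + 1)) _ (fun i hi => hstab (n + 1) i (by omega)) (hgood (n + 1) n (by omega))

/-- Among `4 ^ (k * k) + 1` consecutive indices, two carry the same pair of relative orders of
length `k`. -/
theorem exists_repeat (k s : ℕ) (w w' : ℕ → ℕ → ℚ) :
    ∃ t t', s ≤ t ∧ t < t' ∧ t' ≤ s + 4 ^ (k * k) ∧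
      SameOrder (w t) (w t') k ∧ SameOrder (w' t) (w' t') k := by
  classical
  let code : Fin (4 ^ (k * k) + 1) → (Fin k × Fin k → Bool × Bool) := fun t p =>
    (decide (w (s + t) p.1 < w (s + t) p.2), decide (w' (s + t) p.1 < w' (s + t) p.2))
  obtain ⟨t, t', hne, he⟩ := Fintype.exists_ne_map_eq_of_card_lt code (by simp)
  have key : ∀ t t' : Fin (4 ^ (k * k) + 1), code t = code t' →
      SameOrder (w (s + t)) (w (s + t')) k ∧ SameOrder (w' (s + t)) (w' (s + t')) k := by
    intro t t' he
    constructor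
    · intro i hi j hj
      have := congrArg Prod.fst (congrFun he (⟨i, hi⟩, ⟨j, hj⟩))
      simpa [code] using this
    · intro i hi j hj
      have := congrArg Prod.snd (congrFun he (⟨i, hi⟩, ⟨j, hj⟩))
      simpa [code] using this
  have hne' : (t : ℕ) ≠ t' := fun h => hne (Fin.ext h)
  rcases lt_or_gt_of_ne hne' with h | h
  · exact ⟨s + t, s + t', by omega, by omega, by omega, key t t' he⟩
  · exact ⟨s + t', s + t, by omega, by omega, by omega, key t' t he.symm⟩

/-! ### Locally determined classes of sequences and splicing -/

/-- A class `C f n` of finite sequences `f 0, …, f (n - 1)` of distinct rationals that depends on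
the relative order only, is closed under taking blocks, and is determined by the blocks of
length `b`. -/
structure IsLocalClass (C : (ℕ → ℚ) → ℕ → Prop) (b : ℕ) : Prop where
  pos : 1 ≤ b
  inj : ∀ {f n}, C f n → Inj f n
  block : ∀ {f n o k}, C f n → o + k ≤ n → C (shift o f) k
  congr : ∀ {f g n}, SameOrder f g n → C f n → C g n
  of_windows : ∀ {f n}, b ≤ n → Inj f n → (∀ o, o + b ≤ n → C (shift o f) b) → C f n

namespace IsLocalClass

variable {C : (ℕ → ℚ) → ℕ → Prop} {b : ℕ}

theorem take (hC : IsLocalClass C b) {f : ℕ → ℚ} {n k : ℕ} (h : C f n) (hk : k ≤ n) : C f k := by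
  simpa using hC.block (o := 0) h (by omega)

/-- Two members of the class that overlap in at least `b` positions can be glued. -/
theorem splice (hC : IsLocalClass C b) {M a c : ℕ} (hM : b ≤ M) {f g : ℕ → ℚ} (hf : C f (a + M))
    (hg : C g (M + c)) (hfg : SameOrder (shift a f) g M) :
    ∃ h, C h (a + M + c) ∧ SameOrder h f (a + M) ∧ SameOrder (shift a h) g (M + c) := by
  have hfi := hC.inj hf
  have hgi := hC.inj hg
  obtain ⟨h, hinj, hX, hY⟩ := amalgam (Finset.range (a + M)) (Finset.Ico a (a + M + c)) f
    (fun i => g (i - a))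
    (by
      intro i hi j hj hij
      simp only [Finset.coe_range, Set.mem_Iio] at hi hj
      exact hfi i hi j hj hij)
    (by
      intro i hi j hj hij
      simp only [Finset.coe_Ico, Set.mem_Ico] at hi hj
      have := hgi (i - a) (by omega) (j - a) (by omega) hij
      omega)
    (by
      intro i hi hi' j hj hj'
      simp only [Finset.mem_range, Finset.mem_Ico] at hi hi' hj hj'
      have := hfg (i - a) (by omega) (j - a) (by omega)
      simpa [show a + (i - a) = i by omega, show a + (j - a) = j by omega] using this)
  have h₁ : SameOrder h f (a + M) := by
    intro i hi j hj
    rw [hX i (by simpa using hi), hX j (by simpa using hj)]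
  have h₂ : SameOrder (shift a h) g (M + c) := by
    intro i hi j hj
    have := hY (a + i) (by simp; omega) (a + j) (by simp; omega)
    simpa using this
  refine ⟨h, hC.of_windows (by omega) ?_ ?_, h₁, h₂⟩
  · intro i hi j hj hij
    refine hinj ?_ ?_ hij <;> simp <;> omega
  · intro o ho
    by_cases hoa : o ≤ a
    · refine hC.congr (h₁.shift (o := o) (k := b) (by omega)).symm ?_
      exact hC.block hf (by omega)
    · have := h₂.shift (o := o - a) (k := b) (by omega)
      rw [shift_shift, show a + (o - a) = o by omega] at this
      exact hC.congr this.symm (hC.block hg (by omega))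

end IsLocalClass

/-- The `b` terms of `f` from position `a` on, followed by the terms at the positions `i`
and `j`. -/
def markedWindow (b : ℕ) (f : ℕ → ℚ) (i j a : ℕ) : ℕ → ℚ := fun k =>
  if k < b then f (a + k) else if k = b then f i else f j

/-- If the windows at `a` and at `d` have the same position relative to each other and to two
marked entries, one on the left of both and one on the right of both, then the window at `a` can
be continued in the way the window at `d` is, with the relative order of the marked entries
kept. For `a < d` this removes a part of the sequence, for `d < a` it repeats one. -/
theorem IsLocalClass.splice_marked {C : (ℕ → ℚ) → ℕ → Prop} {b : ℕ} (hC : IsLocalClass C b)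
    {f : ℕ → ℚ} {a d c i x : ℕ} (hf : C f (d + b + c)) (hfa : a + b ≤ d + b + c) (hia : i < a)
    (hid : i < d) (hbx : b ≤ x) (hxc : x < b + c) (hax : a + b ≤ d + x)
    (hw : SameOrder (markedWindow b f i (d + x) a) (markedWindow b f i (d + x) d) (b + 2)) :
    ∃ h, C h (a + b + c) ∧ SameOrder h f (a + b) ∧ SameOrder (shift a h) (shift d f) (b + c) ∧
      ∀ p < a + b, (h p < h (a + x) ↔ f p < f (d + x)) ∧
        (h (a + x) < h p ↔ f (d + x) < f p) := by
  have hfi := hC.inj hf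
  obtain ⟨h, hinj, hX, hY⟩ := amalgam (insert (a + x) (Finset.range (a + b)))
    (insert i (Finset.Ico a (a + b + c)))
    (fun p => if p < a + b then f p else f (d + x))
    (fun p => if p < a then f p else f (d + (p - a)))
    (by
      intro p hp q hq hpq
      simp only [Finset.coe_insert, Finset.coe_range, Set.mem_insert_iff, Set.mem_Iio] at hp hq
      dsimp only at hpq
      split_ifs at hpq with h₁ h₂ h₂
      · exact hfi p (by omega) q (by omega) hpq
      · have := hfi p (by omega) (d + x) (by omega) hpq
        omega
      · have := hfi (d + x) (by omega) q (by omega) hpq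
        omega
      · omega)
    (by
      intro p hp q hq hpq
      simp only [Finset.coe_insert, Finset.coe_Ico, Set.mem_insert_iff, Set.mem_Ico] at hp hq
      dsimp only at hpq
      split_ifs at hpq with h₁ h₂ h₂
      · omega
      · have := hfi p (by omega) (d + (q - a)) (by omega) hpq
        omega
      · have := hfi (d + (p - a)) (by omega) q (by omega) hpq
        omega
      · have := hfi (d + (p - a)) (by omega) (d + (q - a)) (by omega) hpq
        omega)
    (by
      have hcode : ∀ p, p ∈ insert (a + x) (Finset.range (a + b)) →
          p ∈ insert i (Finset.Ico a (a + b + c)) → ∃ k < b + 2,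
          (if p < a + b then f p else f (d + x)) = markedWindow b f i (d + x) a k ∧
          (if p < a then f p else f (d + (p - a))) = markedWindow b f i (d + x) d k := by
        intro p hp hp'
        simp only [Finset.mem_insert, Finset.mem_range, Finset.mem_Ico] at hp hp'
        by_cases hpi : p = i
        · refine ⟨b, by omega, ?_⟩
          subst hpi
          simp [markedWindow, hia, show p < a + b by omega]
        · by_cases hpx : p = a + x
          · refine ⟨b + 1, by omega, ?_⟩
            subst hpx
            simp [markedWindow, show ¬ x < b by omega]
          · refine ⟨p - a, by omega, ?_⟩
            simp [markedWindow, show p - a < b by omega, show ¬ p < a by omega,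
              show p < a + b by omega, show a + (p - a) = p by omega]
      intro p hp hp' q hq hq'
      obtain ⟨k, hk, h₁, h₂⟩ := hcode p hp hp'
      obtain ⟨l, hl, h₃, h₄⟩ := hcode q hq hq'
      rw [h₁, h₂, h₃, h₄]
      exact hw k hk l hl)
  have h₁ : SameOrder h f (a + b) := by
    intro p hp q hq
    rw [hX p (by simp; omega), hX q (by simp; omega), if_pos hp, if_pos hq]
  have h₂ : SameOrder (shift a h) (shift d f) (b + c) := by
    intro p hp q hq
    have := hY (a + p) (by simp; omega) (a + q) (by simp; omega)
    simpa using this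
  refine ⟨h, hC.of_windows (by omega) ?_ ?_, h₁, h₂, ?_⟩
  · intro p hp q hq hpq
    refine hinj ?_ ?_ hpq <;> simp <;> omega
  · intro o ho
    by_cases hoa : o ≤ a
    · refine hC.congr (h₁.shift (o := o) (k := b) (by omega)).symm ?_
      exact hC.block hf (by omega)
    · have := h₂.shift (o := o - a) (k := b) (by omega)
      rw [shift_shift, shift_shift, show a + (o - a) = o by omega] at this
      exact hC.congr this.symm (hC.block hf (by omega))
  · intro p hp
    rw [hX p (by simp; omega), hX (a + x) (by simp), if_pos hp, if_neg (by omega)]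
    exact ⟨Iff.rfl, Iff.rfl⟩

theorem IsLocalClass.of_sameLocal {C : (ℕ → ℚ) → ℕ → Prop} {b : ℕ} (hC : IsLocalClass C b)
    {f g : ℕ → ℚ} {n : ℕ} (hn : b ≤ n) (hf : Inj f n) (hfg : SameLocal b f g n) (hg : C g n) :
    C f n :=
  hC.of_windows hn hf fun _ ho => hC.congr (hfg.window ho).symm (hC.block hg ho)

/-! ### Antichains from periodic stretches -/

/-- The class `C` contains an infinite sequence of members of increasing lengths none of which
embeds into a later one. -/
def HasAntichain (C : (ℕ → ℚ) → ℕ → Prop) : Prop :=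
  ∃ (n : ℕ → ℕ) (τ : ℕ → ℕ → ℚ), (∀ k, C (τ k) (n k)) ∧ StrictMono n ∧
    ∀ k m, k < m → ¬ Embeds (τ k) (n k) (τ m) (n m)

/-- The windows of length `M` of `f` at position `i` and of `g` at position `j` are order
isomorphic. -/
abbrev SameWindow (M : ℕ) (f : ℕ → ℚ) (i : ℕ) (g : ℕ → ℚ) (j : ℕ) : Prop :=
  SameOrder (shift i f) (shift j g) M

/-- In the sequence of the windows of length `M` of `f`, the period `p` holds at the positions
`1, …, r` and breaks at the positions `0` and `r + 1`. In the graph of windows this is a closed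
walk that has an edge coming in and an edge going out. -/
structure IsolatedPeriod (M p r : ℕ) (f : ℕ → ℚ) : Prop where
  period_pos : 1 ≤ p
  pos : 1 ≤ r
  same : ∀ i, 1 ≤ i → i ≤ r → SameWindow M f i f (i + p)
  left : ¬ SameWindow M f 0 f p
  right : ¬ SameWindow M f (r + 1) f (r + 1 + p)

namespace IsolatedPeriod

variable {C : (ℕ → ℚ) → ℕ → Prop} {b M p r : ℕ} {f : ℕ → ℚ}

/-- A periodic stretch that is broken at both ends can be lengthened by one period. -/
theorem pump (hC : IsLocalClass C b) (hM : b ≤ M) (h : IsolatedPeriod M p r f)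
    (hf : C f (p + r + 1 + M)) :
    ∃ g, C g (p + (r + p) + 1 + M) ∧ IsolatedPeriod M p (r + p) g := by
  have hp := h.period_pos
  have hr := h.pos
  -- `g` follows `f` up to the window at `p + 1` and continues as `f` does after the equal window
  -- at `1`.
  obtain ⟨g, hg, h₁, h₂⟩ := hC.splice (a := p + 1) (c := p + r) hM (f := f) (g := shift 1 f)
    (hC.take hf (by omega)) (hC.block hf (by omega))
    (by have := h.same 1 le_rfl hr; rw [add_comm p 1]; exact this.symm)
  have hA : ∀ i, i ≤ p + 1 → SameWindow M g i f i := fun i hi => h₁.shift (by omega)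
  have hB : ∀ i j, p + 1 ≤ i → i ≤ p + (r + p) + 1 → i = j + p → SameWindow M g i f j := by
    intro i j hi hi' hij
    have := h₂.shift (o := i - (p + 1)) (k := M) (by omega)
    rw [shift_shift, shift_shift] at this
    rwa [show p + 1 + (i - (p + 1)) = i by omega, show 1 + (i - (p + 1)) = j by omega] at this
  refine ⟨g, by convert hg using 1; omega, hp, by omega, ?_, ?_, ?_⟩
  · intro i hi hir
    refine SameOrder.trans ?_ (hB (i + p) i (by omega) (by omega) rfl).symm
    by_cases hip : i ≤ p + 1
    · exact hA i hip
    · obtain ⟨j, rfl⟩ : ∃ j, i = j + p := ⟨i - p, by omega⟩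
      exact (hB _ j (by omega) (by omega) rfl).trans (h.same j (by omega) (by omega))
  · intro hc
    exact h.left ((hA 0 (by omega)).symm.trans (hc.trans (hA p (by omega))))
  · intro hc
    exact h.right ((hB (r + p + 1) (r + 1) (by omega) (by omega) (by omega)).symm.trans
      (hc.trans (hB (r + p + 1 + p) (r + 1 + p) (by omega) (by omega) (by omega))))

/-- A long periodic stretch that is broken at both ends can be shortened by one period. -/
theorem cut (hC : IsLocalClass C b) (hM : b ≤ M) (h : IsolatedPeriod M p (r + p) f) (hr : 1 ≤ r)
    (hf : C f (p + (r + p) + 1 + M)) :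
    ∃ g, C g (p + r + 1 + M) ∧ IsolatedPeriod M p r g := by
  have hp := h.period_pos
  -- `g` follows `f` up to the window at `1` and continues as `f` does after the equal window at
  -- `p + 1`.
  obtain ⟨g, hg, h₁, h₂⟩ := hC.splice (a := 1) (c := p + r) hM (f := f) (g := shift (p + 1) f)
    (hC.take hf (by omega)) (hC.block hf (by omega))
    (by have := h.same 1 le_rfl (by omega); rwa [add_comm p 1])
  have hA : ∀ i, i ≤ 1 → SameWindow M g i f i := fun i hi => h₁.shift (by omega)
  have hB : ∀ i, 1 ≤ i → i ≤ p + r + 1 → SameWindow M g i f (i + p) := by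
    intro i hi hi'
    have := h₂.shift (o := i - 1) (k := M) (by omega)
    rw [shift_shift, shift_shift] at this
    rwa [show 1 + (i - 1) = i by omega, show p + 1 + (i - 1) = i + p by omega] at this
  refine ⟨g, by convert hg using 1; omega, hp, by omega, ?_, ?_, ?_⟩
  · intro i hi hir
    exact (hB i hi (by omega)).trans ((h.same (i + p) (by omega) (by omega)).trans
      (hB (i + p) (by omega) (by omega)).symm)
  · intro hc
    exact h.left ((hA 0 (by omega)).symm.trans (hc.trans ((hB p hp (by omega)).trans
      (h.same p hp (by omega)).symm)))
  · intro hc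
    refine h.right ?_
    have h₃ := (hB (r + 1) (by omega) (by omega)).symm.trans (hc.trans
      (hB (r + 1 + p) (by omega) (by omega)))
    rwa [show r + 1 + p = r + p + 1 by omega] at h₃

/-- Stretches with the same isolated period and different lengths do not embed into each
other: the position of either end of the stretch is recognised by the break of the period. -/
theorem not_embeds {r' : ℕ} {g : ℕ → ℚ} (h : IsolatedPeriod M p r f)
    (h' : IsolatedPeriod M p r' g) (hr : r < r') :
    ¬ Embeds f (p + r + 1 + M) g (p + r' + 1 + M) := by
  rintro ⟨o, ho, hfg⟩
  have hW : ∀ i, i ≤ p + r + 1 → SameWindow M f i g (o + i) := by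
    intro i hi
    have := hfg.shift (o := i) (k := M) (by omega)
    rwa [shift_shift] at this
  rcases Nat.eq_zero_or_pos o with rfl | hpos
  · refine h.right ((hW (r + 1) (by omega)).trans (SameOrder.trans ?_
      (hW (r + 1 + p) (by omega)).symm))
    simpa using h'.same (r + 1) (by omega) (by omega)
  · exact h.left ((hW 0 (by omega)).trans (SameOrder.trans (h'.same o hpos (by omega))
      (hW p (by omega)).symm))

theorem hasAntichain (hC : IsLocalClass C b) (hM : b ≤ M) (h : IsolatedPeriod M p r f)
    (hf : C f (p + r + 1 + M)) : HasAntichain C := by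
  have hex : ∀ k, ∃ g, C g (p + (r + k * p) + 1 + M) ∧ IsolatedPeriod M p (r + k * p) g := by
    intro k
    induction k with
    | zero => exact ⟨f, by simpa using hf, by simpa using h⟩
    | succ k ih =>
      obtain ⟨g, hg, hg'⟩ := ih
      have := hg'.pump hC hM hg
      rwa [show r + k * p + p = r + (k + 1) * p by ring] at this
  choose τ hτ hτ' using hex
  have hp := h.period_pos
  have hmono : ∀ k m, k < m → k * p < m * p := fun k m hkm => Nat.mul_lt_mul_of_pos_right hkm hp
  refine ⟨_, τ, hτ, fun k m hkm => ?_, fun k m hkm => ?_⟩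
  · have := hmono k m hkm
    dsimp only
    omega
  · have := hmono k m hkm
    exact (hτ' k).not_embeds (hτ' m) (by omega)

/-- Cutting out periods repeatedly makes the number `r` of positions at which the period holds at
most `p`. -/
theorem exists_short (hC : IsLocalClass C b) (hM : b ≤ M) (h : IsolatedPeriod M p r f)
    (hf : C f (p + r + 1 + M)) :
    ∃ r' ≤ p, ∃ g, C g (p + r' + 1 + M) ∧ IsolatedPeriod M p r' g := by
  induction r using Nat.strong_induction_on generalizing f with
  | _ r ih =>
    by_cases hr : r ≤ p
    · exact ⟨r, hr, f, hf, h⟩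
    · have hp := h.period_pos
      obtain ⟨s, rfl⟩ : ∃ s, r = s + p := ⟨r - p, by omega⟩
      obtain ⟨g, hg, hg'⟩ := h.cut hC hM (by omega) hf
      exact ih s (by omega) hg' hg

/-- A repetition of windows either extends to the end of the sequence, or to its beginning, or
lies in a stretch with an isolated period. -/
theorem of_repeat {N a d : ℕ} (had : a < a + d) (haN : a + d ≤ N)
    (hw : SameWindow M f a f (a + d)) :
    (∀ i, a ≤ i → i + d ≤ N → SameWindow M f i f (i + d)) ∨
    (∀ i ≤ a, SameWindow M f i f (i + d)) ∨
    ∃ s r, s + (d + r + 1) ≤ N ∧ IsolatedPeriod M d r (shift s f) := by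
  classical
  by_contra! hcon
  obtain ⟨⟨i, hai, hiN, hi⟩, ⟨j, hja, hj⟩, hno⟩ := hcon
  -- `e` is the first break of the period after `a`, and `s` below is the last one before `a`.
  have hex : ∃ e, a ≤ e ∧ ¬ SameWindow M f e f (e + d) := ⟨i, hai, hi⟩
  obtain ⟨hea, he⟩ := Nat.find_spec hex
  have hei := Nat.find_min' hex ⟨hai, hi⟩
  have hemin : ∀ x, a ≤ x → x < Nat.find hex → SameWindow M f x f (x + d) := by
    intro x hx hxe
    by_contra hc
    exact Nat.find_min hex hxe ⟨hx, hc⟩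
  generalize Nat.find hex = e at hea he hei hemin
  have hsspec := Nat.findGreatest_spec (P := fun x => ¬ SameWindow M f x f (x + d)) hja hj
  have hsle := Nat.findGreatest_le (P := fun x => ¬ SameWindow M f x f (x + d)) a
  have hsmax : ∀ x, Nat.findGreatest (fun x => ¬ SameWindow M f x f (x + d)) a < x → x ≤ a →
      SameWindow M f x f (x + d) := by
    intro x hx hxa
    by_contra hc
    exact Nat.findGreatest_is_greatest hx hxa hc
  generalize Nat.findGreatest (fun x => ¬ SameWindow M f x f (x + d)) a = s at *
  have hsa : s ≠ a := by rintro rfl; exact hsspec hw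
  have hae : e ≠ a := by rintro rfl; exact he hw
  refine hno s (e - 1 - s) (by omega) ⟨by omega, by omega, ?_, ?_, ?_⟩
  · intro x hx hxr
    rw [SameWindow, shift_shift, shift_shift, ← add_assoc]
    by_cases hxa : s + x ≤ a
    · exact hsmax _ (by omega) hxa
    · exact hemin _ (by omega) (by omega)
  · rw [SameWindow, shift_shift, shift_shift, add_zero]
    exact hsspec
  · rw [SameWindow, shift_shift, shift_shift, show s + (e - 1 - s + 1) = e by omega,
      show s + (e - 1 - s + 1 + d) = e + d by omega]
    exact he

end IsolatedPeriod

/-! ### Antichains from undetermined pairs -/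

/-- The relative order of the entries of `F` at the positions `i` and `i + d` is not determined by
the local order of `F` between these positions. -/
def Undetermined (b : ℕ) (F : ℕ → ℚ) (i d : ℕ) : Prop :=
  ∃ f g : ℕ → ℚ, Inj f (d + 1) ∧ Inj g (d + 1) ∧ SameLocal b f (shift i F) (d + 1) ∧
    SameLocal b g (shift i F) (d + 1) ∧ f 0 < f d ∧ g d < g 0

namespace Undetermined

variable {b : ℕ} {F : ℕ → ℚ} {i d : ℕ}

theorem le (h : Undetermined b F i d) : b ≤ d := by
  obtain ⟨f, g, -, -, hf, hg, h₁, h₂⟩ := h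
  by_contra hlt
  have h₃ := (hf 0 (by omega) d (by omega) (by omega) (by omega)).1 h₁
  have h₄ := (hg d (by omega) 0 (by omega) (by omega) (by omega)).1 h₂
  exact lt_asymm h₃ h₄

theorem congr {G : ℕ → ℚ} {j : ℕ} (h : Undetermined b F i d)
    (hFG : SameLocal b (shift i F) (shift j G) (d + 1)) : Undetermined b G j d := by
  obtain ⟨f, g, hfi, hgi, hf, hg, h₁, h₂⟩ := h
  exact ⟨f, g, hfi, hgi, hf.trans hFG, hg.trans hFG, h₁, h₂⟩

theorem shift_iff {o : ℕ} : Undetermined b (shift o F) i d ↔ Undetermined b F (o + i) d := by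
  simp only [Undetermined, shift_shift]

/-- Let the pair `s, s + d` be undetermined, while the pairs of `s` with closer entries are
determined. Then in every realisation `G` of the local order from `s` on, the entry at `s` lies in
the gap between the entries of the window in which the entry at `s + d` has to be inserted. -/
theorem gap {s : ℕ} (h : Undetermined b F s d)
    (hmin : ∀ e < d, ¬ Undetermined b F s e)
    {G : ℕ → ℚ} (hGi : Inj G d) (hG : SameLocal b G (shift s F) d) {u : ℕ} (hud : u < d)
    (hdu : d < u + b) :
    (F (s + d) < F (s + u) → G 0 < G u) ∧ (F (s + u) < F (s + d) → G u < G 0) := by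
  have hbd := h.le
  obtain ⟨f, g, hfi, hgi, hf, hg, h₁, h₂⟩ := h
  constructor
  · intro hlt
    by_contra hnot
    have hGu : G u < G 0 := lt_of_le_of_ne (not_lt.1 hnot) fun e => by
      have := hGi u hud 0 (by omega) e
      omega
    have hfu : f d < f u := (hf d (by omega) u (by omega) (by omega) (by omega)).2 hlt
    exact hmin u hud ⟨f, G, hfi.mono (by omega), hGi.mono (by omega), hf.mono (by omega),
      hG.mono (by omega), h₁.trans hfu, hGu⟩
  · intro hlt
    by_contra hnot
    have hGu : G 0 < G u := lt_of_le_of_ne (not_lt.1 hnot) fun e => by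
      have := hGi 0 (by omega) u hud e
      omega
    have hgu : g u < g d := (hg u (by omega) d (by omega) (by omega) (by omega)).2 hlt
    exact hmin u hud ⟨G, g, hGi.mono (by omega), hgi.mono (by omega), hG.mono (by omega),
      hg.mono (by omega), hGu, hgu.trans h₂⟩

end Undetermined

/-- The conditions at position `n` on a realisation `g` of the local order of `F` that inserts each
new entry at the top of its gap, except that at the positions in `S` the new entry is put below
the entry `d` steps earlier. -/
structure InsertedAt (b : ℕ) (F : ℕ → ℚ) (S : Set ℕ) (d n : ℕ) (g : ℕ → ℚ) : Prop where
  window : ∀ u < n, n < u + b → (g u < g n ↔ F u < F n) ∧ (g n < g u ↔ F n < F u)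
  ne : ∀ u < n, g u ≠ g n
  low : n ∈ S → g n < g (n - d) ∧ ∀ u < n, n < u + b → g n < g u → g (n - d) < g u
  top : n ∉ S → ∀ i < n, g n < g i → ∃ u < n, n < u + b ∧ g n < g u ∧ g u ≤ g i

namespace InsertedAt

variable {b : ℕ} {F : ℕ → ℚ} {S : Set ℕ} {d n : ℕ} {g : ℕ → ℚ}

theorem inj (h : ∀ i < n, InsertedAt b F S d i g) : Inj g n := by
  intro i hi j hj hij
  by_contra hne
  rcases lt_or_gt_of_ne hne with hlt | hlt
  · exact (h j hj).ne i hlt hij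
  · exact (h i hi).ne j hlt hij.symm

theorem sameLocal (h : ∀ i < n, InsertedAt b F S d i g) : SameLocal b g F n := by
  intro i hi j hj hij hji
  rcases lt_trichotomy i j with hlt | rfl | hlt
  · exact ((h j hj).window i hlt hji).1
  · simp
  · exact ((h i hi).window j hlt hij).2

/-- An insertion below an entry outside the window never looks like an insertion at the top of
the gap, wherever it is embedded. -/
theorem mem_of_embeds {S' : Set ℕ} {h : ℕ → ℚ} {N o x : ℕ} (hb : 1 ≤ b) (hbd : b ≤ d)
    (hdx : d ≤ x) (hx : x < N)
    (hg : InsertedAt b F S d x g) (hxS : x ∈ S) (hh : InsertedAt b F S' d (o + x) h)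
    (hgh : SameOrder g (shift o h) N) : o + x ∈ S' := by
  by_contra hnot
  obtain ⟨hlow, hgap⟩ := hg.low hxS
  have hlow' : h (o + x) < h (o + (x - d)) := (hgh x hx (x - d) (by omega)).1 hlow
  obtain ⟨u, hu, hub, h₁, h₂⟩ := hh.top hnot (o + (x - d)) (by omega) hlow'
  obtain ⟨v, rfl⟩ : ∃ v, u = o + v := ⟨u - o, by omega⟩
  have h₃ := hgap v (by omega) (by omega) ((hgh x hx v (by omega)).2 h₁)
  exact absurd ((hgh (x - d) (by omega) v (by omega)).1 h₃) (not_lt.2 h₂)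

/-- The value `v` is placed just below those entries of the window that `F` puts above the new one
and, at the positions in `S`, also below the entry `d` steps earlier, and above every entry that lies
below all of these. -/
theorem exists_step (hb : 1 ≤ b) (hF : ∀ n, Inj F n)
    (hmin : ∀ s ∈ S, d ≤ s ∧ Undetermined b F (s - d) d ∧
      ∀ e < d, ¬ Undetermined b F (s - d) e)
    (h : ∀ i < n, InsertedAt b F S d i g) :
    ∃ v, InsertedAt b F S d n (Function.update g n v) := by
  classical
  have hgi := inj h
  have hgl := sameLocal h
  have hgap : n ∈ S → ∀ u < n, n < u + b →
      (F n < F u → g (n - d) < g u) ∧ (F u < F n → g u < g (n - d)) := by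
    intro hn u hu hub
    obtain ⟨hdn, hU, hmin'⟩ := hmin n hn
    have hbd := hU.le
    have := hU.gap hmin' (G := shift (n - d) g) (hgi.shift (by omega)) (hgl.shift (by omega))
      (u := u - (n - d)) (by omega) (by omega)
    simpa [show n - d + d = n by omega, show n - d + (u - (n - d)) = u by omega] using this
  obtain ⟨v, hv₁, hv₂⟩ := exists_value_below ((Finset.range n).image g)
    ((((Finset.range n).filter fun u => n < u + b ∧ F n < F u).image g) ∪
      (if n ∈ S then {g (n - d)} else ∅))
  have hUmem : ∀ x, x ∈ ((((Finset.range n).filter fun u => n < u + b ∧ F n < F u).image g) ∪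
      (if n ∈ S then {g (n - d)} else ∅)) ↔
      (∃ u < n, n < u + b ∧ F n < F u ∧ g u = x) ∨ (n ∈ S ∧ x = g (n - d)) := by
    intro x
    rw [Finset.mem_union]
    refine or_congr ?_ ?_
    · simp only [Finset.mem_image, Finset.mem_filter, Finset.mem_range]
      constructor
      · rintro ⟨u, ⟨h₁, h₂, h₃⟩, h₄⟩; exact ⟨u, h₁, h₂, h₃, h₄⟩
      · rintro ⟨u, h₁, h₂, h₃, h₄⟩; exact ⟨u, ⟨h₁, h₂, h₃⟩, h₄⟩
    · split_ifs with hn <;> simp [hn]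
  simp only [hUmem] at hv₁ hv₂
  have hup : ∀ u < n, n < u + b → F n < F u → v < g u := fun u hu hub hlt =>
    hv₁ _ (Or.inl ⟨u, hu, hub, hlt, rfl⟩)
  have hdn : ∀ u < n, n < u + b → F u < F n → g u < v := by
    intro u hu hub hlt
    refine hv₂ _ (Finset.mem_image_of_mem _ (Finset.mem_range.2 hu)) ?_
    rintro x (⟨w, hw, hwb, hlt', rfl⟩ | ⟨hn, rfl⟩)
    · exact (hgl u hu w hw (by omega) (by omega)).2 (hlt.trans hlt')
    · exact (hgap hn u hu hub).2 hlt
  have hFne : ∀ u < n, F u ≠ F n := by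
    intro u hu he
    have := hF (n + 1) u (by omega) n (by omega) he
    omega
  have hvn : ∀ i < n, v < g i → ∃ x, ((∃ u < n, n < u + b ∧ F n < F u ∧ g u = x) ∨
      (n ∈ S ∧ x = g (n - d))) ∧ x ≤ g i := by
    intro i hi hlt
    by_contra! hcon
    exact absurd hlt (not_lt.2 (hv₂ _ (Finset.mem_image_of_mem _ (Finset.mem_range.2 hi))
      hcon).le)
  have hupd : ∀ u < n, Function.update g n v u = g u := fun u hu =>
    Function.update_of_ne (by omega) _ _
  have hdpos : n ∈ S → n - d < n := by
    intro hn
    obtain ⟨hdn, hU, -⟩ := hmin n hn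
    have := hU.le
    omega
  refine ⟨v, ⟨?_, ?_, ?_, ?_⟩⟩
  · intro u hu hub
    rw [hupd u hu, Function.update_self]
    rcases lt_or_gt_of_ne (hFne u hu) with hlt | hlt
    · have := hdn u hu hub hlt
      exact ⟨⟨fun _ => hlt, fun _ => this⟩, ⟨fun h => absurd this h.asymm,
        fun h => absurd hlt h.asymm⟩⟩
    · have := hup u hu hub hlt
      exact ⟨⟨fun h => absurd this h.asymm, fun h => absurd hlt h.asymm⟩,
        ⟨fun _ => hlt, fun _ => this⟩⟩
  · intro u hu
    rw [hupd u hu, Function.update_self]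
    intro he
    by_cases hall : ∀ x, ((∃ u < n, n < u + b ∧ F n < F u ∧ g u = x) ∨
      (n ∈ S ∧ x = g (n - d))) → g u < x
    · exact (hv₂ _ (Finset.mem_image_of_mem _ (Finset.mem_range.2 hu)) hall).ne he
    · push Not at hall
      obtain ⟨x, hx, hle⟩ := hall
      exact ((hv₁ x hx).trans_le hle).ne' he
  · intro hn
    rw [hupd _ (hdpos hn), Function.update_self]
    refine ⟨hv₁ _ (Or.inr ⟨hn, rfl⟩), fun u hu hub hlt => ?_⟩
    rw [hupd u hu] at hlt ⊢
    refine (hgap hn u hu hub).1 ?_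
    by_contra hnot
    exact hlt.asymm (hdn u hu hub (lt_of_le_of_ne (not_lt.1 hnot) (hFne u hu)))
  · intro hn i hi hlt
    rw [hupd i hi, Function.update_self] at hlt
    obtain ⟨x, hx | hx, hxi⟩ := hvn i hi hlt
    · obtain ⟨u, hu, hub, hFu, rfl⟩ := hx
      refine ⟨u, hu, hub, ?_, ?_⟩
      · rw [hupd u hu, Function.update_self]
        exact hup u hu hub hFu
      · rwa [hupd u hu, hupd i hi]
    · exact absurd hx.1 hn

theorem exists_realisation (hb : 1 ≤ b) (hF : ∀ n, Inj F n)
    (hmin : ∀ s ∈ S, d ≤ s ∧ Undetermined b F (s - d) d ∧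
      ∀ e < d, ¬ Undetermined b F (s - d) e) :
    ∃ g : ℕ → ℚ, ∀ n, InsertedAt b F S d n g := by
  refine exists_seq (fun n g => InsertedAt b F S d n g) ?_
    fun n g h => exists_step hb hF hmin h
  intro n g g' hgg' h
  have e : ∀ u < n, g' u = g u := fun u hu => (hgg' u hu.le).symm
  have en : g' n = g n := (hgg' n le_rfl).symm
  constructor
  · intro u hu hub
    rw [e u hu, en]
    exact h.window u hu hub
  · intro u hu
    rw [e u hu, en]
    exact h.ne u hu
  · intro hn
    have e' : g' (n - d) = g (n - d) := (hgg' _ (by omega)).symm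
    rw [en, e']
    refine ⟨(h.low hn).1, fun u hu hub => ?_⟩
    rw [e u hu]
    exact (h.low hn).2 u hu hub
  · intro hn i hi
    rw [en, e i hi]
    intro hlt
    obtain ⟨u, hu, hub, h₁, h₂⟩ := h.top hn i hi hlt
    exact ⟨u, hu, hub, by rwa [e u hu], by rwa [e u hu]⟩

end InsertedAt

theorem sameLocal_mul_period {b p : ℕ} {F : ℕ → ℚ} (hper : ∀ i, SameWindow b F i F (i + p))
    (k i n : ℕ) (hn : b ≤ n) : SameLocal b (shift i F) (shift (i + k * p) F) n := by
  induction k with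
  | zero => simpa using SameLocal.refl b (shift i F) n
  | succ k ih =>
    refine ih.trans (SameLocal.of_windows (fun o _ => ?_) hn)
    rw [shift_shift, shift_shift]
    have := hper (i + k * p + o)
    rwa [show i + k * p + o + p = i + (k + 1) * p + o by ring] at this

/-- A periodic local order with an undetermined pair has an infinite antichain of
realisations: such a pair is ordered the wrong way at the two ends only. -/
theorem HasAntichain.of_periodic {C : (ℕ → ℚ) → ℕ → Prop} {b p : ℕ} (hC : IsLocalClass C b)
    {F : ℕ → ℚ} (hF : ∀ n, C F n) (hp : 1 ≤ p) (hper : ∀ i, SameWindow b F i F (i + p))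
    (hU : ∃ d i, Undetermined b F i d) : HasAntichain C := by
  classical
  -- Choose an undetermined pair of least distance, so that `Undetermined.gap` applies.
  obtain ⟨i₀, hi₀⟩ := Nat.find_spec hU
  have hmin₀ : ∀ e < Nat.find hU, ∀ i, ¬ Undetermined b F i e := fun e he i h =>
    Nat.find_min hU he ⟨i, h⟩
  generalize Nat.find hU = d at hi₀ hmin₀
  have hbd := hi₀.le
  have hFi : ∀ n, Inj (shift i₀ F) n := fun n => (hC.inj (hF (i₀ + n))).shift le_rfl
  have hk : ∀ k, Undetermined b (shift i₀ F) (k * p) d := by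
    intro k
    rw [Undetermined.shift_iff]
    exact hi₀.congr (sameLocal_mul_period hper k i₀ (d + 1) (by omega))
  -- All entries are inserted at the top of their gaps, except for two at distance `(m + 1) * p`.
  have hex : ∀ m, ∃ g : ℕ → ℚ, ∀ n,
      InsertedAt b (shift i₀ F) {d, (m + 1) * p + d} d n g := by
    intro m
    refine InsertedAt.exists_realisation hC.pos hFi ?_
    rintro s (rfl | rfl)
    · refine ⟨le_rfl, by simpa using hk 0, fun e he => ?_⟩
      rw [Undetermined.shift_iff]
      exact hmin₀ e he _
    · refine ⟨by omega, by simpa using hk (m + 1), fun e he => ?_⟩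
      rw [Undetermined.shift_iff]
      exact hmin₀ e he _
  choose τ hτ using hex
  have hmono : ∀ k m, k < m → (k + 1) * p < (m + 1) * p := fun k m hkm =>
    Nat.mul_lt_mul_of_pos_right (by omega) hp
  refine ⟨fun m => (m + 1) * p + d + 1, τ, fun m => ?_, fun k m hkm => ?_, fun k m hkm => ?_⟩
  · exact hC.of_sameLocal (by dsimp only; omega) (InsertedAt.inj fun i _ => hτ m i)
      (InsertedAt.sameLocal fun i _ => hτ m i) (hC.block (hF (i₀ + _)) le_rfl)
  · have := hmono k m hkm
    dsimp only
    omega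
  · rintro ⟨o, ho, hgh⟩
    dsimp only at ho hgh
    have hlt := hmono k m hkm
    have hkp : p ≤ (k + 1) * p := Nat.le_mul_of_pos_left p (by omega)
    -- An embedding maps the exceptional positions of `τ k` to those of `τ m`, whose distance is
    -- larger.
    have h₁ := (hτ k d).mem_of_embeds hC.pos hbd le_rfl (by omega) (by simp) (hτ m (o + d)) hgh
    have h₂ := (hτ k ((k + 1) * p + d)).mem_of_embeds hC.pos hbd (by omega) (by omega) (by simp)
      (hτ m (o + ((k + 1) * p + d))) hgh
    simp only [Set.mem_insert_iff, Set.mem_singleton_iff] at h₁ h₂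
    omega

/-- Cut `F` after each of a sequence of positions at which it increases, and move the first entry to
just below the last one. No two of the results agree on an initial part, since the moved entry lies
above the entries at all the earlier of these positions. -/
theorem exists_relocated {b : ℕ} {F : ℕ → ℚ} (hF : ∀ n, Inj F n) {l : ℕ → ℕ}
    (hl : StrictMono l) (hpos : ∀ k, b ≤ l k) (hb : 1 ≤ b)
    (hinc : ∀ k m, k < m → F (l k) < F (l m))
    (hgap : ∀ k u, 1 ≤ u → u < b →
      (F u < F 0 → F u < F (l k)) ∧ (F 0 < F u → F (l k) < F u)) :
    ∃ τ : ℕ → ℕ → ℚ, ∀ k, Inj (τ k) (l k + 1) ∧ SameLocal b (τ k) F (l k + 1) ∧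
      ∀ m, k < m → ¬ SameOrder (τ k) (τ m) (l k + 1) := by
  have hex : ∀ k, ∃ v, v < F (l k) ∧ ∀ i ≤ l k, F i < F (l k) → F i < v := by
    intro k
    obtain ⟨v, h₁, h₂⟩ := exists_value_below ((Finset.range (l k + 1)).image F) {F (l k)}
    refine ⟨v, h₁ _ (by simp), fun i hi hlt => h₂ _ ?_ (by simpa using hlt)⟩
    exact Finset.mem_image_of_mem _ (by simp; omega)
  choose v hv₁ hv₂ using hex
  have hupd : ∀ k i, i ≠ 0 → Function.update F 0 (v k) i = F i := fun k i hi =>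
    Function.update_of_ne hi _ _
  have hne : ∀ k i, i ≤ l k → F i ≠ v k := by
    intro k i hi he
    rcases lt_or_ge (F i) (F (l k)) with hlt | hge
    · exact (hv₂ k i hi hlt).ne he
    · exact ((hv₁ k).trans_le hge).ne' he
  refine ⟨fun k => Function.update F 0 (v k), fun k => ⟨?_, ?_, ?_⟩⟩
  · intro i hi j hj hij
    dsimp only at hij
    rcases Nat.eq_zero_or_pos i with rfl | hi0 <;> rcases Nat.eq_zero_or_pos j with rfl | hj0
    · rfl
    · rw [Function.update_self, hupd k j (by omega)] at hij
      exact absurd hij.symm (hne k j (by omega))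
    · rw [Function.update_self, hupd k i (by omega)] at hij
      exact absurd hij (hne k i (by omega))
    · rw [hupd k i (by omega), hupd k j (by omega)] at hij
      exact hF (l k + 1) i hi j hj hij
  · have key : ∀ u, 1 ≤ u → u < b → (F u < v k ↔ F u < F 0) ∧ (v k < F u ↔ F 0 < F u) := by
      intro u hu hub
      have hlk := hpos k
      rcases lt_trichotomy (F u) (F 0) with h | h | h
      · have := hv₂ k u (by omega) ((hgap k u hu hub).1 h)
        exact ⟨⟨fun _ => h, fun _ => this⟩, ⟨fun h' => absurd this h'.asymm,
          fun h' => absurd h h'.asymm⟩⟩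
      · have := hF (u + 1) u (by omega) 0 (by omega) h
        omega
      · have := (hv₁ k).trans ((hgap k u hu hub).2 h)
        exact ⟨⟨fun h' => absurd this h'.asymm, fun h' => absurd h h'.asymm⟩,
          ⟨fun _ => h, fun _ => this⟩⟩
    intro i hi j hj hij hji
    dsimp only
    rcases Nat.eq_zero_or_pos i with rfl | hi0 <;> rcases Nat.eq_zero_or_pos j with rfl | hj0
    · simp
    · rw [Function.update_self, hupd k j (by omega)]
      exact (key j hj0 (by omega)).2
    · rw [Function.update_self, hupd k i (by omega)]
      exact (key i hi0 (by omega)).1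
    · rw [hupd k i (by omega), hupd k j (by omega)]
  · intro m hkm hs
    have hlk := hpos k
    have h₁ := hs 0 (by omega) (l k) (by omega)
    dsimp only at h₁
    rw [Function.update_self, Function.update_self, hupd _ _ (by omega),
      hupd _ _ (by omega)] at h₁
    exact (h₁.1 (hv₁ k)).asymm (hv₂ m (l k) (hl hkm).le (hinc k m hkm))

theorem sameLocal_neg {b n : ℕ} {f g : ℕ → ℚ} (h : SameLocal b f (-g) n) :
    SameLocal b (-f) g n := by
  intro i hi j hj hij hji
  have := h j hj i hi hji hij
  simpa using this

/-- An entry that forms undetermined pairs with infinitely many entries, while all later entries do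
so at bounded distance only, gives an infinite antichain. -/
theorem HasAntichain.of_first {C : (ℕ → ℚ) → ℕ → Prop} {b : ℕ} (hC : IsLocalClass C b)
    {F : ℕ → ℚ} (hF : ∀ n, C F n) (hinf : {d | Undetermined b F 0 d}.Infinite) {M : ℕ}
    (hM : ∀ i, 1 ≤ i → ∀ d, M ≤ d → ¬ Undetermined b F i d) : HasAntichain C := by
  have hFi : ∀ n, Inj F n := fun n => hC.inj (hF n)
  -- The order of the entries at `u` and at `d` is determined, and `0` can be put on either side of
  -- `d`. So the entry at `d` lies in the same gap between the entries near `0` as the entry at `0`.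
  have hgap : ∀ d, M + b ≤ d → Undetermined b F 0 d → ∀ u, 1 ≤ u → u < b →
      (F u < F 0 → F u < F d) ∧ (F 0 < F u → F d < F u) := by
    intro d hd hU u hu hub
    obtain ⟨f, g, hfi, hgi, hf, hg, h₁, h₂⟩ := hU
    rw [shift_zero] at hf hg
    have hFu : F u ≠ F d := fun e => by
      have := hFi (d + 1) u (by omega) d (by omega) e
      omega
    have hFsub : SameLocal b (shift u F) (shift u F) (d - u + 1) := SameLocal.refl _ _ _
    have hud : u + (d - u) = d := by omega
    constructor
    · intro hlt
      by_contra hnot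
      have hdu : F d < F u := lt_of_le_of_ne (not_lt.1 hnot) hFu.symm
      refine hM u hu (d - u) (by omega) ⟨shift u f, shift u F, hfi.shift (by omega),
        (hFi (d + 1)).shift (by omega), hf.shift (by omega), hFsub, ?_, ?_⟩
      · simp only [shift_apply, hud, add_zero]
        exact ((hf u (by omega) 0 (by omega) (by omega) (by omega)).2 hlt).trans h₁
      · simpa only [shift_apply, hud, add_zero] using hdu
    · intro hlt
      by_contra hnot
      have hdu : F u < F d := lt_of_le_of_ne (not_lt.1 hnot) hFu
      refine hM u hu (d - u) (by omega) ⟨shift u F, shift u g, (hFi (d + 1)).shift (by omega),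
        hgi.shift (by omega), hFsub, hg.shift (by omega), ?_, ?_⟩
      · simpa only [shift_apply, hud, add_zero] using hdu
      · simp only [shift_apply, hud, add_zero]
        exact h₂.trans ((hg 0 (by omega) u (by omega) (by omega) (by omega)).2 hlt)
  have hinf' : {d | Undetermined b F 0 d ∧ M + b ≤ d}.Infinite := by
    refine (hinf.sdiff (Set.finite_lt_nat (M + b))).mono ?_
    rintro d ⟨h₁, h₂⟩
    exact ⟨h₁, not_lt.1 h₂⟩
  have hanti : ∃ l : ℕ → ℕ, StrictMono l ∧ (∀ k, Undetermined b F 0 (l k) ∧ M + b ≤ l k) ∧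
      ∃ τ : ℕ → ℕ → ℚ, ∀ k, Inj (τ k) (l k + 1) ∧ SameLocal b (τ k) F (l k + 1) ∧
        ∀ m, k < m → ¬ SameOrder (τ k) (τ m) (l k + 1) := by
    have hx : ∀ k, Undetermined b F 0 (Nat.nth _ k) ∧ M + b ≤ Nat.nth _ k :=
      Nat.nth_mem_of_infinite hinf'
    have hxm : StrictMono (Nat.nth fun d => Undetermined b F 0 d ∧ M + b ≤ d) :=
      Nat.nth_strictMono hinf'
    generalize Nat.nth (fun d => Undetermined b F 0 d ∧ M + b ≤ d) = x at hx hxm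
    -- Pass to a subsequence on which `F` is monotone; the decreasing case is reduced to the
    -- increasing one by negation.
    obtain ⟨s, hs | hs⟩ := exists_increasing_or_nonincreasing_subseq
      (fun i j : ℕ => F i < F j) x
    · have hl : StrictMono fun k => x (s k) := hxm.comp s.strictMono
      refine ⟨fun k => x (s k), hl, fun k => hx _, ?_⟩
      exact exists_relocated hFi hl (fun k => by have := (hx (s k)).2; omega) hC.pos hs
        fun k u hu hub => hgap _ (hx _).2 (hx _).1 u hu hub
    · have hl : StrictMono fun k => x (s k) := hxm.comp s.strictMono
      refine ⟨fun k => x (s k), hl, fun k => hx _, ?_⟩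
      obtain ⟨τ, hτ⟩ := exists_relocated (b := b) (F := -F) (l := fun k => x (s k))
        (fun n i hi j hj hij => hFi n i hi j hj (by simpa using hij)) hl
        (fun k => by have := (hx (s k)).2; omega) hC.pos
        (by
          intro k m hkm
          have hne : F (x (s k)) ≠ F (x (s m)) := fun e => by
            have h₁ := hl hkm
            have := hFi (x (s m) + 1) _ (by dsimp only at h₁; omega) _ (by omega) e
            dsimp only at h₁
            omega
          have := lt_of_le_of_ne (not_lt.1 (hs k m hkm)) hne.symm
          simpa using this)
        (by
          intro k u hu hub
          have := hgap _ (hx (s k)).2 (hx (s k)).1 u hu hub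
          simpa using this.symm)
      refine ⟨fun k => -τ k, fun k => ⟨?_, sameLocal_neg (hτ k).2.1, ?_⟩⟩
      · intro i hi j hj hij
        exact (hτ k).1 i hi j hj (by simpa using hij)
      · intro m hkm hsame
        refine (hτ k).2.2 m hkm fun i hi j hj => ?_
        have := hsame j hj i hi
        simpa using this
  obtain ⟨l, hl, hlU, τ, hτ⟩ := hanti
  have hCτ : ∀ k, C (τ k) (l k + 1) := fun k =>
    hC.of_sameLocal (by have := (hlU k).2; omega) (hτ k).1 (hτ k).2.1 (hF _)
  refine ⟨fun k => l k + 1, τ, hCτ, fun k m hkm => by have := hl hkm; dsimp only; omega, ?_⟩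
  rintro k m hkm ⟨o, ho, hemb⟩
  rcases Nat.eq_zero_or_pos o with rfl | hpos
  · rw [shift_zero] at hemb
    exact (hτ k).2.2 m hkm hemb
  -- An embedding with positive offset makes a later entry part of a long undetermined pair.
  · refine hM o hpos (l k) (by have := (hlU k).2; omega) ((hlU k).1.congr ?_)
    rw [shift_zero]
    exact (hτ k).2.1.symm.trans ((hemb.sameLocal b).trans ((hτ m).2.1.shift ho))

/-- An eventually periodic local order in which the first entry forms undetermined pairs with
infinitely many entries gives an infinite antichain. -/
theorem HasAntichain.of_eventually_periodic {C : (ℕ → ℚ) → ℕ → Prop} {b p q : ℕ}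
    (hC : IsLocalClass C b) {F : ℕ → ℚ} (hF : ∀ n, C F n) (hp : 1 ≤ p)
    (hper : ∀ i, q ≤ i → SameWindow b F i F (i + p))
    (hinf : {d | Undetermined b F 0 d}.Infinite) : HasAntichain C := by
  classical
  by_cases h : ∃ i, q ≤ i ∧ ∃ d, Undetermined b F i d
  · obtain ⟨i, hi, d, hd⟩ := h
    refine HasAntichain.of_periodic hC (F := shift i F) (fun n => hC.block (hF (i + n)) le_rfl) hp
      (fun j => ?_) ⟨d, 0, Undetermined.shift_iff.2 (by simpa using hd)⟩
    rw [SameWindow, shift_shift, shift_shift, ← add_assoc]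
    exact hper _ (by omega)
  · push Not at h
    have hSfin : {i | {d | Undetermined b F i d}.Infinite}.Finite := by
      refine (Set.finite_lt_nat q).subset fun i hi => ?_
      obtain ⟨d, hd⟩ := Set.Infinite.nonempty hi
      exact not_le.1 fun hqi => h i hqi d hd
    -- `s` is the last entry that forms undetermined pairs with infinitely many entries.
    obtain ⟨s, hs, hmax⟩ := Set.exists_max_image _ id hSfin ⟨0, hinf⟩
    have hfin : {d | ∃ i < q, s < i ∧ Undetermined b F i d}.Finite := by
      refine ((Set.finite_lt_nat q).biUnion (t := fun i => {d | s < i ∧ Undetermined b F i d})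
        fun i _ => ?_).subset ?_
      · by_contra hinf'
        obtain ⟨d, hd⟩ := Set.Infinite.nonempty hinf'
        have hsi : s < i := hd.1
        have : i ≤ s := hmax i (Set.Infinite.mono (fun d hd => hd.2) hinf')
        omega
      · rintro d ⟨i, hi, hd⟩
        exact Set.mem_biUnion hi hd
    obtain ⟨M, hM⟩ := hfin.bddAbove
    refine HasAntichain.of_first hC (F := shift s F) (M := M + 1)
      (fun n => hC.block (hF (s + n)) le_rfl) ?_ ?_
    · simpa only [Undetermined.shift_iff, add_zero, Set.mem_ofPred_eq] using hs
    · intro i hi d hd hU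
      rw [Undetermined.shift_iff] at hU
      rcases lt_or_ge (s + i) q with hlt | hge
      · have : d ≤ M := hM ⟨s + i, hlt, by omega, hU⟩
        omega
      · exact h _ hge d hU

/-! ### Long undetermined pairs -/

/-- Two members of the class of length `l + 1` with the same local order that order their first and
last entries differently. -/
structure SplitPair (C : (ℕ → ℚ) → ℕ → Prop) (b l : ℕ) (f g : ℕ → ℚ) : Prop where
  left : C f (l + 1)
  right : C g (l + 1)
  same : SameLocal b f g (l + 1)
  lt : f 0 < f l
  gt : g l < g 0

/-- A local order with a repeated window can be continued periodically. -/
theorem IsLocalClass.exists_periodic {C : (ℕ → ℚ) → ℕ → Prop} {b : ℕ} (hC : IsLocalClass C b)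
    {f : ℕ → ℚ} {t p N : ℕ} (hf : C f (N + b)) (hp : 1 ≤ p) (htp : t + p ≤ N)
    (hper : ∀ i, t ≤ i → i + p ≤ N → SameWindow b f i f (i + p)) :
    ∃ F : ℕ → ℚ, (∀ n, C F n) ∧ (∀ i < N + b, F i = f i) ∧
      ∀ i, t ≤ i → SameWindow b F i F (i + p) := by
  classical
  have hb := hC.pos
  have hfi := hC.inj hf
  -- The sequence starts as `f` does; each later entry is inserted into its window as the entry
  -- `p` steps earlier is.
  let Good : ℕ → (ℕ → ℚ) → Prop := fun n g =>
    (n < N + b → g n = f n) ∧ (∀ u < n, g u ≠ g n) ∧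
    (N + b ≤ n → ∀ u < n, n < u + b →
      (g u < g n ↔ g (u - p) < g (n - p)) ∧ (g n < g u ↔ g (n - p) < g (u - p)))
  have hperiod : ∀ n g, (∀ i < n, Good i g) → ∀ x < n, ∀ y < n, t + p ≤ x → t + p ≤ y →
      x < y + b → y < x + b → (g x < g y ↔ g (x - p) < g (y - p)) := by
    intro n g h x hx y hy htx hty hxy hyx
    by_cases hlt : x < N + b ∧ y < N + b
    · obtain ⟨w, hw₁, hw₂, hw₃, hw₄, hw₅, hw₆⟩ : ∃ w, t ≤ w ∧ w + p ≤ N ∧ w + p ≤ x ∧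
          w + p ≤ y ∧ x < w + p + b ∧ y < w + p + b :=
        ⟨min (min x y) N - p, by omega, by omega, by omega, by omega, by omega, by omega⟩
      have := hper w hw₁ hw₂ (x - p - w) (by omega) (y - p - w) (by omega)
      simp only [shift_apply, show w + (x - p - w) = x - p by omega,
        show w + (y - p - w) = y - p by omega, show w + p + (x - p - w) = x by omega,
        show w + p + (y - p - w) = y by omega] at this
      rw [(h x hx).1 hlt.1, (h y hy).1 hlt.2, (h (x - p) (by omega)).1 (by omega),
        (h (y - p) (by omega)).1 (by omega), this]
    · rcases lt_trichotomy x y with hxy' | rfl | hxy'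
      · exact ((h y hy).2.2 (by omega) x hxy' hyx).1
      · simp
      · exact ((h x hx).2.2 (by omega) y hxy' hxy).2
  obtain ⟨F, hF⟩ : ∃ F, ∀ n, Good n F := by
    refine exists_seq Good ?_ ?_
    · rintro n g g' hgg' ⟨h₁, h₂, h₃⟩
      have e : ∀ u ≤ n, g' u = g u := fun u hu => (hgg' u hu).symm
      refine ⟨fun hn => by rw [e n le_rfl, h₁ hn], fun u hu => ?_, fun hn u hu hub => ?_⟩
      · rw [e n le_rfl, e u hu.le]
        exact h₂ u hu
      · rw [e n le_rfl, e u hu.le, e (u - p) (by omega), e (n - p) (by omega)]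
        exact h₃ hn u hu hub
    · intro n g h
      have hupd : ∀ v, ∀ u < n, Function.update g n v u = g u := fun v u hu =>
        Function.update_of_ne (by omega) _ _
      by_cases hn : n < N + b
      · refine ⟨f n, fun _ => Function.update_self .., fun u hu => ?_, fun h' => by omega⟩
        rw [hupd _ u hu, Function.update_self, (h u hu).1 (by omega)]
        intro he
        have := hfi u (by omega) n hn he
        omega
      · have hpn := hperiod n g h
        obtain ⟨v, hv₁, hv₂⟩ := exists_value_below ((Finset.range n).image g)
          (((Finset.range n).filter fun u => n < u + b ∧ g (n - p) < g (u - p)).image g)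
        have hup : ∀ u < n, n < u + b → g (n - p) < g (u - p) → v < g u :=
          fun u hu hub hlt => hv₁ _ (Finset.mem_image_of_mem _
            (Finset.mem_filter.2 ⟨Finset.mem_range.2 hu, hub, hlt⟩))
        have hdn : ∀ u < n, n < u + b → g (u - p) < g (n - p) → g u < v := by
          intro u hu hub hlt
          refine hv₂ _ (Finset.mem_image_of_mem _ (Finset.mem_range.2 hu)) fun x hx => ?_
          obtain ⟨w, hw, rfl⟩ := Finset.mem_image.1 hx
          simp only [Finset.mem_filter, Finset.mem_range] at hw
          exact (hpn u hu w hw.1 (by omega) (by omega) (by omega) (by omega)).2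
            (hlt.trans hw.2.2)
        have hne : ∀ u < n, g u ≠ v := by
          intro u hu he
          by_cases hall : ∀ x ∈ (((Finset.range n).filter fun u =>
              n < u + b ∧ g (n - p) < g (u - p)).image g), g u < x
          · exact (hv₂ _ (Finset.mem_image_of_mem _ (Finset.mem_range.2 hu)) hall).ne he
          · push Not at hall
            obtain ⟨x, hx, hle⟩ := hall
            exact ((hv₁ x hx).trans_le hle).ne' he
        refine ⟨v, fun h' => absurd h' hn, fun u hu => ?_, fun _ u hu hub => ?_⟩
        · rw [hupd v u hu, Function.update_self]
          exact hne u hu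
        · rw [hupd v u hu, Function.update_self, hupd v _ (by omega), hupd v _ (by omega)]
          have hne' : g (u - p) ≠ g (n - p) := (h (n - p) (by omega)).2.1 (u - p) (by omega)
          rcases lt_or_gt_of_ne hne' with hlt | hlt
          · have := hdn u hu hub hlt
            exact ⟨⟨fun _ => hlt, fun _ => this⟩,
              ⟨fun h' => absurd this h'.asymm, fun h' => absurd hlt h'.asymm⟩⟩
          · have := hup u hu hub hlt
            exact ⟨⟨fun h' => absurd this h'.asymm, fun h' => absurd hlt h'.asymm⟩,
              ⟨fun _ => hlt, fun _ => this⟩⟩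
  have hFper : ∀ i, t ≤ i → SameWindow b F i F (i + p) := by
    intro i hi x hx y hy
    have := hperiod (i + p + b) F (fun j _ => hF j) (i + p + x) (by omega) (i + p + y) (by omega)
      (by omega) (by omega) (by omega) (by omega)
    simp only [shift_apply, this, show i + p + x - p = i + x by omega,
      show i + p + y - p = i + y by omega]
  have hFf : ∀ i < N + b, F i = f i := fun i hi => (hF i).1 hi
  have hFi : ∀ n, Inj F n := by
    intro n i _ j _ hij
    by_contra hne
    rcases lt_or_gt_of_ne hne with hlt | hlt
    · exact (hF j).2.1 i hlt hij
    · exact (hF i).2.1 j hlt hij.symm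
  have hwin : ∀ o, C (shift o F) b := by
    intro o
    induction o using Nat.strong_induction_on with
    | _ o ih =>
      by_cases ho : o ≤ N
      · refine hC.congr (f := shift o f) ?_ (hC.block hf (by omega))
        intro x hx y hy
        simp only [shift_apply, hFf (o + x) (by omega), hFf (o + y) (by omega)]
      · have := hFper (o - p) (by omega)
        rw [SameWindow, show o - p + p = o by omega] at this
        exact hC.congr this (ih (o - p) (by omega))
  refine ⟨F, fun n => ?_, hFf, hFper⟩
  rcases le_or_gt b n with hbn | hbn
  · exact hC.of_windows hbn (hFi n) fun o _ => hwin o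
  · have := hwin 0
    rw [shift_zero] at this
    exact hC.take this hbn.le

namespace SplitPair

variable {C : (ℕ → ℚ) → ℕ → Prop} {b l : ℕ} {f g : ℕ → ℚ}

/-- Both members of a split pair can be cut or pumped at once, by `IsLocalClass.splice_marked` with
their first and last entries marked. -/
theorem splice (hC : IsLocalClass C b) {a d x : ℕ} (hp : SplitPair C b (d + x) f g) (ha : 1 ≤ a)
    (hd : 1 ≤ d) (hx : b ≤ x) (hax : a + b ≤ d + x)
    (hwf : SameOrder (markedWindow b f 0 (d + x) a) (markedWindow b f 0 (d + x) d) (b + 2))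
    (hwg : SameOrder (markedWindow b g 0 (d + x) a) (markedWindow b g 0 (d + x) d) (b + 2)) :
    ∃ f' g', SplitPair C b (a + x) f' g' ∧ SameOrder f' f (a + b) ∧
      SameOrder (shift a f') (shift d f) (x + 1) ∧
      ∀ w ≤ a,
        SameOrder (markedWindow b f' 0 (a + x) w) (markedWindow b f 0 (d + x) w) (b + 2) ∧
        SameOrder (markedWindow b g' 0 (a + x) w) (markedWindow b g 0 (d + x) w) (b + 2) := by
  have hb := hC.pos
  have key : ∀ f : ℕ → ℚ, C f (d + x + 1) →
      SameOrder (markedWindow b f 0 (d + x) a) (markedWindow b f 0 (d + x) d) (b + 2) →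
      ∃ f', C f' (a + x + 1) ∧ SameOrder f' f (a + b) ∧
        SameOrder (shift a f') (shift d f) (x + 1) ∧
        (∀ p < a + b, (f' p < f' (a + x) ↔ f p < f (d + x)) ∧
          (f' (a + x) < f' p ↔ f (d + x) < f p)) ∧
        ∀ w ≤ a,
          SameOrder (markedWindow b f' 0 (a + x) w) (markedWindow b f 0 (d + x) w) (b + 2) := by
    intro f hf hw
    obtain ⟨h, h₁, h₂, h₃, h₄⟩ := hC.splice_marked (a := a) (d := d) (c := x + 1 - b) (i := 0)
      (x := x) (f := f) (by convert hf using 1; omega) (by omega) (by omega) (by omega) hx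
      (by omega) hax hw
    refine ⟨h, by convert h₁ using 1; omega, h₂, by convert h₃ using 1; omega, h₄, ?_⟩
    intro w hwa p hp q hq
    have hcode : ∀ p < b + 2, (∃ r < a + b, markedWindow b h 0 (a + x) w p = h r ∧
        markedWindow b f 0 (d + x) w p = f r) ∨
        (markedWindow b h 0 (a + x) w p = h (a + x) ∧
        markedWindow b f 0 (d + x) w p = f (d + x)) := by
      intro p hp
      by_cases hpb : p < b
      · exact Or.inl ⟨w + p, by omega, by simp [markedWindow, hpb]⟩
      · by_cases hpb' : p = b
        · exact Or.inl ⟨0, by omega, by simp [markedWindow, hpb']⟩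
        · exact Or.inr (by simp [markedWindow, hpb, hpb'])
    rcases hcode p hp with ⟨r, hr, e₁, e₂⟩ | ⟨e₁, e₂⟩ <;>
      rcases hcode q hq with ⟨s, hs, e₃, e₄⟩ | ⟨e₃, e₄⟩ <;> rw [e₁, e₂, e₃, e₄]
    · exact h₂ r hr s hs
    · exact (h₄ r hr).1
    · exact (h₄ s hs).2
    · simp
  obtain ⟨f', hf, hf₁, hf₂, hf₃, hf₄⟩ := key f hp.left hwf
  obtain ⟨g', hg, hg₁, hg₂, hg₃, hg₄⟩ := key g hp.right hwg
  refine ⟨f', g', ⟨hf, hg, SameLocal.of_windows (fun o ho => ?_) (by omega),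
    (hf₃ 0 (by omega)).1.2 hp.lt, (hg₃ 0 (by omega)).2.2 hp.gt⟩, hf₁, hf₂,
    fun w hw => ⟨hf₄ w hw, hg₄ w hw⟩⟩
  by_cases hoa : o ≤ a
  · exact (hf₁.shift (by omega)).trans
      ((hp.same.window (by omega)).trans (hg₁.shift (by omega)).symm)
  · have e₁ := hf₂.shift (o := o - a) (k := b) (by omega)
    have e₂ := hg₂.shift (o := o - a) (k := b) (by omega)
    rw [shift_shift, shift_shift, show a + (o - a) = o by omega] at e₁ e₂
    exact e₁.trans ((hp.same.window (by omega)).trans e₂.symm)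

theorem exists_repeat (hl : 4 ^ ((b + 2) * (b + 2)) + b + 1 ≤ l) (f g : ℕ → ℚ) :
    ∃ t p, 1 ≤ t ∧ 1 ≤ p ∧ p ≤ 4 ^ ((b + 2) * (b + 2)) ∧ t + p + b ≤ l ∧
      SameOrder (markedWindow b f 0 l t) (markedWindow b f 0 l (t + p)) (b + 2) ∧
      SameOrder (markedWindow b g 0 l t) (markedWindow b g 0 l (t + p)) (b + 2) := by
  obtain ⟨t, t', h₁, h₂, h₃, h₄, h₅⟩ := ConsecPerm.exists_repeat (b + 2) 1
    (fun a => markedWindow b f 0 l a) (fun a => markedWindow b g 0 l a)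
  obtain ⟨p, rfl⟩ : ∃ p, t' = t + p := ⟨t' - t, by omega⟩
  exact ⟨t, p, h₁, by omega, by omega, by omega, h₄, h₅⟩

/-- Long split pairs can be shortened. -/
theorem exists_short (hC : IsLocalClass C b) (hp : SplitPair C b l f g)
    (hl : 4 ^ ((b + 2) * (b + 2)) + b + 1 ≤ l) :
    ∃ l' f' g', 4 ^ ((b + 2) * (b + 2)) + b + 1 ≤ l' ∧
      l' < 4 ^ ((b + 2) * (b + 2)) + b + 1 + 4 ^ ((b + 2) * (b + 2)) ∧
      SplitPair C b l' f' g' := by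
  induction l using Nat.strong_induction_on generalizing f g with
  | _ l ih =>
    by_cases hlt : l < 4 ^ ((b + 2) * (b + 2)) + b + 1 + 4 ^ ((b + 2) * (b + 2))
    · exact ⟨l, f, g, hl, hlt, hp⟩
    · obtain ⟨t, p, ht, hp₁, hpS, htl, hwf, hwg⟩ := exists_repeat hl f g
      obtain ⟨x, rfl⟩ : ∃ x, l = t + p + x := ⟨l - (t + p), by omega⟩
      obtain ⟨f', g', h, -⟩ := hp.splice hC ht (by omega) (by omega) (by omega) hwf hwg
      exact ih (t + x) (by omega) h (by omega)

theorem window_eq {t t' i j : ℕ} (h : SameOrder (markedWindow b f i j t)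
    (markedWindow b f i j t') (b + 2)) : SameWindow b f t f t' := by
  intro x hx y hy
  have := h x (by omega) y (by omega)
  simpa [markedWindow, hx, hy] using this

/-- Repeating the part between two equal marked windows gives arbitrarily long split pairs on one
eventually periodic local order. -/
theorem hasAntichain_of_period (hC : IsLocalClass C b) (hp : SplitPair C b l f g) {t p : ℕ}
    (ht : 1 ≤ t) (hp₁ : 1 ≤ p) (htl : t + p + b ≤ l)
    (hwf : SameOrder (markedWindow b f 0 l t) (markedWindow b f 0 l (t + p)) (b + 2))
    (hwg : SameOrder (markedWindow b g 0 l t) (markedWindow b g 0 l (t + p)) (b + 2))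
    (hper : ∀ i, t ≤ i → i + p + b ≤ l + 1 → SameWindow b f i f (i + p)) :
    HasAntichain C := by
  obtain ⟨F, hFC, hFf, hFper⟩ := hC.exists_periodic (N := l + 1 - b) (f := f) (t := t) (p := p)
    (by convert hp.left using 1; omega) hp₁ (by omega) (fun i hi hi' => hper i hi (by omega))
  -- The repeated marked window at `t` and `t + p` is kept, so that the insertion of a period can be
  -- iterated.
  have key : ∀ k, ∃ f' g', SplitPair C b (l + k * p) f' g' ∧
      SameLocal b f' F (l + k * p + 1) ∧
      SameOrder (markedWindow b f' 0 (l + k * p) t) (markedWindow b f' 0 (l + k * p) (t + p))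
        (b + 2) ∧
      SameOrder (markedWindow b g' 0 (l + k * p) t) (markedWindow b g' 0 (l + k * p) (t + p))
        (b + 2) := by
    intro k
    induction k with
    | zero =>
      refine ⟨f, g, by simpa using hp, ?_, by simpa using hwf, by simpa using hwg⟩
      intro i hi j hj _ _
      rw [hFf i (by omega), hFf j (by omega)]
    | succ k ih =>
      obtain ⟨f', g', h, hloc, hf, hg⟩ := ih
      obtain ⟨x, hx⟩ : ∃ x, l + k * p = t + x := ⟨l + k * p - t, by omega⟩
      rw [hx] at h hloc hf hg
      obtain ⟨f'', g'', h', h₁, h₂, h₃⟩ := h.splice hC (a := t + p) (d := t) (by omega) ht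
        (by omega) (by omega) hf.symm hg.symm
      have hl' : l + (k + 1) * p = t + p + x := by
        rw [add_mul, one_mul]; omega
      rw [hl']
      refine ⟨f'', g'', h', SameLocal.of_windows (fun o ho => ?_) (by omega),
        (h₃ t (by omega)).1.trans (hf.trans (h₃ (t + p) le_rfl).1.symm),
        (h₃ t (by omega)).2.trans (hg.trans (h₃ (t + p) le_rfl).2.symm)⟩
      by_cases hot : o ≤ t + p
      · exact (h₁.shift (by omega)).trans (hloc.window (by omega))
      · have e := h₂.shift (o := o - (t + p)) (k := b) (by omega)
        rw [shift_shift, shift_shift, show t + p + (o - (t + p)) = o by omega,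
          show t + (o - (t + p)) = o - p by omega] at e
        have e' := hFper (o - p) (by omega)
        rw [SameWindow, show o - p + p = o by omega] at e'
        exact e.trans ((hloc.window (by omega)).trans e')
  refine HasAntichain.of_eventually_periodic hC hFC hp₁ hFper ?_
  refine Set.infinite_of_injective_forall_mem (f := fun k => l + k * p) ?_ fun k => ?_
  · intro k k' hkk
    have : k * p = k' * p := by simpa using hkk
    exact Nat.eq_of_mul_eq_mul_right hp₁ this
  · obtain ⟨f', g', h, hloc, -⟩ := key k
    refine ⟨f', g', hC.inj h.left, hC.inj h.right, ?_, ?_, h.lt, h.gt⟩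
    · rwa [shift_zero]
    · rw [shift_zero]
      exact h.same.symm.trans hloc

end SplitPair

/-! ### Reversal -/

/-- The class of the reversals of the members of `C`. -/
def revClass (C : (ℕ → ℚ) → ℕ → Prop) (f : ℕ → ℚ) (n : ℕ) : Prop :=
  C (fun i => f (n - 1 - i)) n

theorem SameOrder.reverse {f g : ℕ → ℚ} {n : ℕ} (h : SameOrder f g n) :
    SameOrder (fun i => f (n - 1 - i)) (fun i => g (n - 1 - i)) n :=
  fun i _ j _ => h (n - 1 - i) (by omega) (n - 1 - j) (by omega)

theorem IsLocalClass.rev {C : (ℕ → ℚ) → ℕ → Prop} {b : ℕ} (hC : IsLocalClass C b) :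
    IsLocalClass (revClass C) b where
  pos := hC.pos
  inj := by
    intro f n h i hi j hj hij
    have := hC.inj h (n - 1 - i) (by omega) (n - 1 - j) (by omega)
      (by simpa [show n - 1 - (n - 1 - i) = i by omega, show n - 1 - (n - 1 - j) = j by omega])
    omega
  block := by
    intro f n o k h hk
    refine hC.congr ?_ (hC.block h (o := n - o - k) (k := k) (by omega))
    intro i hi j hj
    simp only [shift_apply, show n - 1 - (n - o - k + i) = o + (k - 1 - i) by omega,
      show n - 1 - (n - o - k + j) = o + (k - 1 - j) by omega]
  congr := fun h hf => hC.congr h.reverse hf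
  of_windows := by
    intro f n hn hf h
    refine hC.of_windows hn ?_ fun o ho => ?_
    · intro i hi j hj hij
      have := hf (n - 1 - i) (by omega) (n - 1 - j) (by omega) hij
      omega
    · refine hC.congr ?_ (h (n - o - b) (by omega))
      intro i hi j hj
      simp only [shift_apply, show n - 1 - (o + i) = n - o - b + (b - 1 - i) by omega,
        show n - 1 - (o + j) = n - o - b + (b - 1 - j) by omega]

theorem HasAntichain.of_rev {C : (ℕ → ℚ) → ℕ → Prop} (h : HasAntichain (revClass C)) :
    HasAntichain C := by
  obtain ⟨n, τ, hτ, hn, hemb⟩ := h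
  refine ⟨n, fun k i => τ k (n k - 1 - i), hτ, hn, fun k m hkm hem => hemb k m hkm ?_⟩
  obtain ⟨o, ho, hs⟩ := hem
  refine ⟨n m - n k - o, by omega, fun i hi j hj => ?_⟩
  have := hs (n k - 1 - i) (by omega) (n k - 1 - j) (by omega)
  simpa only [shift_apply, show n k - 1 - (n k - 1 - i) = i by omega,
    show n k - 1 - (n k - 1 - j) = j by omega,
    show n m - 1 - (o + (n k - 1 - i)) = n m - n k - o + i by omega,
    show n m - 1 - (o + (n k - 1 - j)) = n m - n k - o + j by omega] using this

namespace SplitPair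

variable {C : (ℕ → ℚ) → ℕ → Prop} {b l : ℕ} {f g : ℕ → ℚ}

theorem reverse (hp : SplitPair C b l f g) (hC : IsLocalClass C b) :
    SplitPair (revClass C) b l (fun i => g (l - i)) (fun i => f (l - i)) where
  left := by
    refine hC.congr ?_ hp.right
    intro i hi j hj
    simp only [show l - (l + 1 - 1 - i) = i by omega, show l - (l + 1 - 1 - j) = j by omega]
  right := by
    refine hC.congr ?_ hp.left
    intro i hi j hj
    simp only [show l - (l + 1 - 1 - i) = i by omega, show l - (l + 1 - 1 - j) = j by omega]
  same := fun i hi j hj hij hji =>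
    (hp.same (l - i) (by omega) (l - j) (by omega) (by omega) (by omega)).symm
  lt := by simpa using hp.gt
  gt := by simpa using hp.lt

theorem markedWindow_reverse {t t' : ℕ} (ht : t + b ≤ l + 1) (ht' : t' + b ≤ l + 1)
    (h : SameOrder (markedWindow b f 0 l t) (markedWindow b f 0 l t') (b + 2)) :
    SameOrder (markedWindow b (fun i => f (l - i)) 0 l (l + 1 - b - t))
      (markedWindow b (fun i => f (l - i)) 0 l (l + 1 - b - t')) (b + 2) := by
  have key : ∀ k < b + 2, ∃ k' < b + 2, ∀ t, t + b ≤ l + 1 →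
      markedWindow b (fun i => f (l - i)) 0 l (l + 1 - b - t) k = markedWindow b f 0 l t k' := by
    intro k hk
    by_cases hkb : k < b
    · refine ⟨b - 1 - k, by omega, fun t ht => ?_⟩
      simp [markedWindow, hkb, show b - 1 - k < b by omega,
        show l - (l + 1 - b - t + k) = t + (b - 1 - k) by omega]
    · by_cases hkb' : k = b
      · exact ⟨b + 1, by omega, fun t ht => by simp [markedWindow, hkb']⟩
      · exact ⟨b, by omega, fun t ht => by simp [markedWindow, hkb, hkb']⟩
  intro i hi j hj
  obtain ⟨i', hi', ei⟩ := key i hi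
  obtain ⟨j', hj', ej⟩ := key j hj
  rw [ei t ht, ei t' ht', ej t ht, ej t' ht']
  exact h i' hi' j' hj'

/-- A class with a long split pair contains an infinite antichain. -/
theorem hasAntichain (hC : IsLocalClass C b) (hp : SplitPair C b l f g)
    (hl : 4 ^ ((b + 2) * (b + 2)) + b + 1 ≤ l) : HasAntichain C := by
  have hb := hC.pos
  obtain ⟨t, p, ht, hp₁, -, htl, hwf, hwg⟩ := exists_repeat hl f g
  have hw := window_eq hwf
  rcases IsolatedPeriod.of_repeat (M := b) (N := l + 1 - b) (f := f) (a := t) (d := p) (by omega)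
    (by omega) hw with h | h | ⟨s, r, hs, h⟩
  · exact hp.hasAntichain_of_period hC ht hp₁ htl hwf hwg fun i hi hi' => h i hi (by omega)
  · refine HasAntichain.of_rev ?_
    have e : l + 1 - b - (t + p) + p = l + 1 - b - t := by omega
    refine (hp.reverse hC).hasAntichain_of_period hC.rev (t := l + 1 - b - (t + p)) (p := p)
      (by omega) hp₁ (by omega) ?_ ?_ ?_
    · rw [e]
      exact (markedWindow_reverse (by omega) (by omega) hwg).symm
    · rw [e]
      exact (markedWindow_reverse (by omega) (by omega) hwf).symm
    · intro i hi hi' x hx y hy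
      have hg := hp.same.window (o := l + 1 - b - i) (by omega)
      have hg' := hp.same.window (o := l + 1 - b - i - p) (by omega)
      have hfw := h (l + 1 - b - i - p) (by omega)
      rw [SameWindow, show l + 1 - b - i - p + p = l + 1 - b - i by omega] at hfw
      have := (hg.symm.trans (hfw.symm.trans hg')) (b - 1 - x) (by omega) (b - 1 - y) (by omega)
      simpa only [shift_apply, show l + 1 - b - i + (b - 1 - x) = l - (i + x) by omega,
        show l + 1 - b - i + (b - 1 - y) = l - (i + y) by omega,
        show l + 1 - b - i - p + (b - 1 - x) = l - (i + p + x) by omega,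
        show l + 1 - b - i - p + (b - 1 - y) = l - (i + p + y) by omega] using this
  · exact h.hasAntichain hC le_rfl (hC.block hp.left (by omega))

end SplitPair

/-! ### Classes without infinite antichains -/

section WithoutAntichain

variable {C : (ℕ → ℚ) → ℕ → Prop} {b m : ℕ}

/-- Without split pairs of length at least `m`, a member is determined by its windows of
length `m`. -/
theorem sameOrder_of_windows (hC : IsLocalClass C b) (hbm : b ≤ m)
    (hsplit : ∀ l, m ≤ l → ∀ f g, ¬ SplitPair C b l f g) {f g : ℕ → ℚ} {n : ℕ} (hmn : m ≤ n)
    (hf : C f n) (hg : C g n) (hw : ∀ o, o + m ≤ n → SameWindow m f o g o) : SameOrder f g n := by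
  have hloc : SameLocal m f g n := SameLocal.of_windows hw hmn
  have hfi := hC.inj hf
  have hgi := hC.inj hg
  have hb : ∀ f g i l, C f n → C g n → SameLocal m f g n → i + l < n → m ≤ l →
      f i < f (i + l) → g i < g (i + l) := by
    intro f g i l hf hg hfg hil hml hlt
    by_contra hnot
    have hgt : g (i + l) < g i := lt_of_le_of_ne (not_lt.1 hnot) fun e => by
      have hb := hC.pos
      have := hC.inj hg (i + l) (by omega) i (by omega) e
      omega
    refine hsplit l hml (shift i f) (shift i g) ⟨hC.block hf (by omega), hC.block hg (by omega),
      fun x hx y hy hxy hyx => ?_, by simpa using hlt, by simpa using hgt⟩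
    exact hfg (i + x) (by omega) (i + y) (by omega) (by omega) (by omega)
  have key : ∀ i j, i < j → j < n → (f i < f j ↔ g i < g j) := by
    intro i j hij hj
    by_cases hm : j < i + m
    · exact hloc i (by omega) j hj (by omega) hm
    · obtain ⟨l, rfl⟩ : ∃ l, j = i + l := ⟨j - i, by omega⟩
      exact ⟨hb f g i l hf hg hloc hj (by omega), hb g f i l hg hf hloc.symm hj (by omega)⟩
  intro i hi j hj
  rcases lt_trichotomy i j with hij | rfl | hij
  · exact key i j hij hj
  · simp
  · have h := key j i hij hi
    have hfne : f i ≠ f j := fun e => hij.ne' (hfi i hi j hj e)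
    have hgne : g i ≠ g j := fun e => hij.ne' (hgi i hi j hj e)
    rw [← not_iff_not, not_lt, not_lt, hfne.symm.le_iff_lt, hgne.symm.le_iff_lt]
    exact h

/-- Without isolated periods, the sequence of windows of a long member is periodic up to some
position `c`, and periodic again a bounded number of steps later. -/
theorem exists_center (hC : IsLocalClass C b)
    (hiso : ∀ p ≤ 4 ^ (m * m), ∀ r f, C f (p + r + 1 + m) → ¬ IsolatedPeriod m p r f)
    {f : ℕ → ℚ} {N : ℕ} (hf : C f (N + m)) (hN : 4 ^ (m * m) ≤ N) :
    ∃ c p q, 1 ≤ p ∧ p ≤ 4 ^ (m * m) ∧ 1 ≤ q ∧ q ≤ 4 ^ (m * m) ∧ c + 4 ^ (m * m) ≤ N + 1 ∧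
      (∀ i < c, SameWindow m f i f (i + p)) ∧
      (∀ i, c + 4 ^ (m * m) ≤ i → i + q ≤ N → SameWindow m f i f (i + q)) := by
  classical
  have hV : 1 ≤ 4 ^ (m * m) := Nat.one_le_pow _ _ (by norm_num)
  -- Within any `4 ^ (m * m)` steps a window repeats, and the resulting period extends to the right
  -- end or to the left end.
  have hblock : ∀ s, s + 4 ^ (m * m) ≤ N →
      (∃ q, 1 ≤ q ∧ q ≤ 4 ^ (m * m) ∧
        ∀ i, s + 4 ^ (m * m) ≤ i → i + q ≤ N → SameWindow m f i f (i + q)) ∨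
      (∃ p, 1 ≤ p ∧ p ≤ 4 ^ (m * m) ∧ ∀ i ≤ s, SameWindow m f i f (i + p)) := by
    intro s hs
    obtain ⟨t, t', h₁, h₂, h₃, hw, -⟩ := exists_repeat m s (fun t => shift t f)
      (fun t => shift t f)
    obtain ⟨d, rfl⟩ : ∃ d, t' = t + d := ⟨t' - t, by omega⟩
    rcases IsolatedPeriod.of_repeat (N := N) (by omega) (by omega) hw with h | h | ⟨x, r, hx, h⟩
    · exact Or.inl ⟨d, by omega, by omega, fun i hi hi' => h i (by omega) hi'⟩
    · exact Or.inr ⟨d, by omega, by omega, fun i hi => h i (by omega)⟩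
    · exact absurd h (hiso d (by omega) r _ (hC.block hf (by omega)))
  generalize 4 ^ (m * m) = V at hN hV hblock
  -- `c` is the first position after which the period extends to the right end.
  let P : ℕ → Prop := fun s => N < s + V ∨
    ∃ q, 1 ≤ q ∧ q ≤ V ∧ ∀ i, s + V ≤ i → i + q ≤ N → SameWindow m f i f (i + q)
  have hex : ∃ s, P s := ⟨N + 1, Or.inl (by omega)⟩
  have hmin : ∀ s < Nat.find hex, s + V ≤ N ∧
      ∃ p, 1 ≤ p ∧ p ≤ V ∧ ∀ i ≤ s, SameWindow m f i f (i + p) := by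
    intro s hs
    have hnot := Nat.find_min hex hs
    have hsN : s + V ≤ N := not_lt.1 fun h => hnot (Or.inl h)
    exact ⟨hsN, (hblock s hsN).resolve_left fun h => hnot (Or.inr h)⟩
  have hspec := Nat.find_spec hex
  generalize Nat.find hex = c at hmin hspec
  have hleft : c + V ≤ N + 1 ∧ ∃ p, 1 ≤ p ∧ p ≤ V ∧ ∀ i < c, SameWindow m f i f (i + p) := by
    rcases Nat.eq_zero_or_pos c with rfl | hc
    · exact ⟨by omega, 1, le_rfl, hV, fun i hi => by omega⟩
    · obtain ⟨h, p, hp, hpV, hper⟩ := hmin (c - 1) (by omega)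
      exact ⟨by omega, p, hp, hpV, fun i hi => hper i (by omega)⟩
  obtain ⟨hcN, p, hp, hpV, hper⟩ := hleft
  rcases hspec with hlt | ⟨q, hq, hqV, hper'⟩
  · exact ⟨c, p, 1, hp, hpV, le_rfl, hV, hcN, hper, fun i hi hi' => by omega⟩
  · exact ⟨c, p, q, hp, hpV, hq, hqV, hcN, hper, hper'⟩

/-- Two sequences of windows with the same periods on the left and on the right that agree around
their centres agree everywhere. -/
theorem sameWindow_of_center {V N N' c c' p q : ℕ} {f g : ℕ → ℚ} (hp : 1 ≤ p) (hpV : p ≤ V)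
    (hq : 1 ≤ q) (hqV : q ≤ V) (hc : c + V ≤ N + 1) (hcc : c ≤ c') (hNN : N - c ≤ N' - c')
    (hf : ∀ i < c, SameWindow m f i f (i + p)) (hg : ∀ i < c', SameWindow m g i g (i + p))
    (hf' : ∀ i, c + V ≤ i → i + q ≤ N → SameWindow m f i f (i + q))
    (hg' : ∀ i, c' + V ≤ i → i + q ≤ N' → SameWindow m g i g (i + q))
    (hmid : ∀ x ≤ 2 * V, SameWindow m f (c + x) g (c' + x)) :
    ∀ i ≤ N, SameWindow m f i g (c' - c + i) := by
  have hright : ∀ x, c + x ≤ N → SameWindow m f (c + x) g (c' + x) := by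
    intro x
    induction x using Nat.strong_induction_on with
    | _ x ih =>
      intro hx
      by_cases hxV : x ≤ 2 * V
      · exact hmid x hxV
      · obtain ⟨y, rfl⟩ : ∃ y, x = y + q := ⟨x - q, by omega⟩
        have h₁ := hf' (c + y) (by omega) (by omega)
        have h₂ := hg' (c' + y) (by omega) (by omega)
        rw [← add_assoc, ← add_assoc]
        exact h₁.symm.trans ((ih y (by omega) (by omega)).trans h₂)
  have hleft : ∀ y ≤ c, SameWindow m f (c - y) g (c' - y) := by
    intro y
    induction y using Nat.strong_induction_on with
    | _ y ih =>
      intro hy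
      rcases Nat.eq_zero_or_pos y with rfl | hy0
      · simpa using hmid 0 (by omega)
      have h₁ := hf (c - y) (by omega)
      have h₂ := hg (c' - y) (by omega)
      refine h₁.trans (SameOrder.trans ?_ h₂.symm)
      by_cases hyp : y ≤ p
      · rw [show c - y + p = c + (p - y) by omega, show c' - y + p = c' + (p - y) by omega]
        exact hright _ (by omega)
      · rw [show c - y + p = c - (y - p) by omega, show c' - y + p = c' - (y - p) by omega]
        exact ih (y - p) (by omega) (by omega)
  intro i hi
  by_cases hic : c ≤ i
  · have := hright (i - c) (by omega)
    rwa [show c + (i - c) = i by omega, show c' + (i - c) = c' - c + i by omega] at this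
  · have := hleft (c - i) (by omega)
    rwa [show c - (c - i) = i by omega, show c' - (c - i) = c' - c + i by omega] at this

/-- Without long split pairs and without isolated periods, every sequence of long members has a
member that embeds into a later one. -/
theorem exists_embeds (hC : IsLocalClass C b) (hbm : b ≤ m)
    (hsplit : ∀ l, m ≤ l → ∀ f g, ¬ SplitPair C b l f g)
    (hiso : ∀ p ≤ 4 ^ (m * m), ∀ r f, C f (p + r + 1 + m) → ¬ IsolatedPeriod m p r f)
    (n : ℕ → ℕ) (τ : ℕ → ℕ → ℚ) (hτ : ∀ k, C (τ k) (n k)) (hn : ∀ k, 4 ^ (m * m) + m ≤ n k) :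
    ∃ i j, i < j ∧ Embeds (τ i) (n i) (τ j) (n j) := by
  classical
  have hV0 : 0 < 4 ^ (m * m) := by positivity
  have hN : ∀ k, ∃ N, n k = N + m := fun k => ⟨n k - m, by have := hn k; omega⟩
  choose N hN using hN
  have hcen := fun k => exists_center hC hiso (f := τ k) (N := N k) (by rw [← hN]; exact hτ k)
    (by have := hn k; have := hN k; omega)
  choose c p q hp hpV hq hqV hcN hleft hright using hcen
  generalize hV : 4 ^ (m * m) = V at hpV hqV hcN hright
  -- The two periods and the windows around the centre take finitely many values. They are constant
  -- on a subsequence, to which Dickson's lemma is applied.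
  let data : ℕ → Fin (V + 1) × Fin (V + 1) × (Fin (2 * V + 1) → Fin m × Fin m → Bool) :=
    fun k => (⟨p k, by have := hpV k; omega⟩, ⟨q k, by have := hqV k; omega⟩,
      fun x ij => decide (τ k (c k + x + ij.1) < τ k (c k + x + ij.2)))
  obtain ⟨y, hy⟩ := Finite.exists_infinite_fiber data
  have hinf : {k | data k = y}.Infinite := Set.infinite_coe_iff.1 hy
  have hmem := Nat.nth_mem_of_infinite hinf
  have hmono := Nat.nth_strictMono hinf
  generalize Nat.nth (fun k => data k = y) = s at hmem hmono
  obtain ⟨i, j, hij, hle⟩ := wellQuasiOrdered_le (α := ℕ × ℕ)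
    fun k => (c (s k), N (s k) - c (s k))
  refine ⟨s i, s j, hmono hij, ?_⟩
  have hdata : data (s i) = data (s j) := (hmem i).trans (hmem j).symm
  obtain ⟨hle₁, hle₂⟩ := Prod.mk_le_mk.1 hle
  have hpe : p (s i) = p (s j) := congrArg (fun z => (z.1 : ℕ)) hdata
  have hqe : q (s i) = q (s j) := congrArg (fun z => (z.2.1 : ℕ)) hdata
  have hmid : ∀ x ≤ 2 * V, SameWindow m (τ (s i)) (c (s i) + x) (τ (s j)) (c (s j) + x) := by
    intro x hx a ha a' ha'
    have := congrArg (fun z => z.2.2 ⟨x, by omega⟩ (⟨a, ha⟩, ⟨a', ha'⟩)) hdata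
    simpa [data] using this
  have hw := sameWindow_of_center (hp (s i)) (hpV (s i)) (hq (s i)) (hqV (s i)) (hcN (s i)) hle₁
    hle₂ (hleft (s i)) (by rw [hpe]; exact hleft (s j)) (hright (s i))
    (by rw [hqe]; exact hright (s j)) hmid
  have hiN := hN (s i)
  have hjN := hN (s j)
  have hVi := hcN (s i)
  have hVj := hcN (s j)
  have hp1 := hp (s i)
  have hp2 := hpV (s i)
  refine ⟨c (s j) - c (s i), by omega, ?_⟩
  refine sameOrder_of_windows hC hbm hsplit (by omega) (hτ (s i))
    (hC.block (hτ (s j)) (by omega)) fun o ho => ?_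
  rw [SameWindow, shift_shift]
  exact hw o (by omega)

end WithoutAntichain

/-- The bounded configurations that are responsible for infinite antichains: a long split pair of
length at most `2 * m`, or a member of the class with an isolated period of its windows of length
`m`. The bounds are those to which such configurations can be cut down. -/
def HasObstruction (C : (ℕ → ℚ) → ℕ → Prop) (b m : ℕ) : Prop :=
  (∃ l < 2 * m, m ≤ l ∧ ∃ f g, SplitPair C b l f g) ∨
  ∃ p < 4 ^ (m * m) + 1, ∃ r < p + 1, ∃ f, C f (p + r + 1 + m) ∧ IsolatedPeriod m p r f

theorem HasObstruction.hasAntichain {C : (ℕ → ℚ) → ℕ → Prop} {b m : ℕ} (hC : IsLocalClass C b)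
    (hm : 4 ^ ((b + 2) * (b + 2)) + b + 1 ≤ m) (h : HasObstruction C b m) : HasAntichain C := by
  have hS : 0 < 4 ^ ((b + 2) * (b + 2)) := by positivity
  rcases h with ⟨l, -, hl, f, g, h⟩ | ⟨p, -, r, -, f, hf, h⟩
  · exact h.hasAntichain hC (by omega)
  · exact h.hasAntichain hC (by omega) hf

theorem exists_embeds_of_not_hasObstruction {C : (ℕ → ℚ) → ℕ → Prop} {b m : ℕ}
    (hC : IsLocalClass C b) (hm : m = 4 ^ ((b + 2) * (b + 2)) + b + 1)
    (h : ¬ HasObstruction C b m) (n : ℕ → ℕ) (τ : ℕ → ℕ → ℚ) (hτ : ∀ k, C (τ k) (n k))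
    (hn : ∀ k, 4 ^ (m * m) + m ≤ n k) : ∃ i j, i < j ∧ Embeds (τ i) (n i) (τ j) (n j) := by
  have hS : 0 < 4 ^ ((b + 2) * (b + 2)) := by positivity
  refine exists_embeds hC (by omega) ?_ ?_ n τ hτ hn
  · intro l hl f g hp
    obtain ⟨l', f', g', h₁, h₂, h₃⟩ := hp.exists_short hC (by omega)
    exact h (Or.inl ⟨l', by omega, by omega, f', g', h₃⟩)
  · intro p hp r f hf hper
    obtain ⟨r', hr', g, hg, hg'⟩ := hper.exists_short hC (by omega) hf
    exact h (Or.inr ⟨p, by omega, r', by omega, g, hg, hg'⟩)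

/-! ### Joint embeddings -/

/-- Some member of the class of length `N` contains both sequences as blocks. -/
def Joins (C : (ℕ → ℚ) → ℕ → Prop) (f : ℕ → ℚ) (n : ℕ) (g : ℕ → ℚ) (k N : ℕ) : Prop :=
  ∃ h, C h N ∧ Embeds f n h N ∧ Embeds g k h N

/-- The window `v` can be reached from the window `u`: some member of the class begins with `u`
and ends with `v`. -/
def Reaches (C : (ℕ → ℚ) → ℕ → Prop) (b : ℕ) (u v : ℕ → ℚ) : Prop :=
  ∃ h c, C h (c + b) ∧ SameOrder u h b ∧ SameOrder v (shift c h) b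

theorem Joins.symm {C : (ℕ → ℚ) → ℕ → Prop} {f g : ℕ → ℚ} {n k N : ℕ} (h : Joins C f n g k N) :
    Joins C g k f n N := by
  obtain ⟨x, hx, h₁, h₂⟩ := h
  exact ⟨x, hx, h₂, h₁⟩

theorem Joins.mono {C : (ℕ → ℚ) → ℕ → Prop} {f g f' g' : ℕ → ℚ} {n k n' k' N : ℕ}
    (h : Joins C f n g k N) (hf : Embeds f' n' f n) (hg : Embeds g' k' g k) :
    Joins C f' n' g' k' N := by
  obtain ⟨x, hx, h₁, h₂⟩ := h
  exact ⟨x, hx, hf.trans h₁, hg.trans h₂⟩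

section Joint

variable {C : (ℕ → ℚ) → ℕ → Prop} {b : ℕ}

/-- The part between two equal windows can be cut out. -/
theorem IsLocalClass.cut (hC : IsLocalClass C b) {f : ℕ → ℚ} {a d n : ℕ} (hf : C f n) (had : a ≤ d)
    (hdn : d + b ≤ n) (hw : SameWindow b f a f d) :
    ∃ h, C h (n - (d - a)) ∧ SameOrder h f (a + b) ∧
      SameOrder (shift a h) (shift d f) (n - d) := by
  obtain ⟨c, rfl⟩ : ∃ c, n = d + b + c := ⟨n - (d + b), by omega⟩
  obtain ⟨h, h₁, h₂, h₃⟩ := hC.splice (a := a) (c := c) le_rfl (hC.take hf (by omega))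
    (hC.block (o := d) hf (by omega)) hw
  exact ⟨h, by convert h₁ using 1; omega, h₂, by convert h₃ using 1; omega⟩

theorem exists_repeat_window (b s : ℕ) (f : ℕ → ℚ) :
    ∃ a d, s ≤ a ∧ a < d ∧ d ≤ s + 4 ^ ((b + 2) * (b + 2)) ∧ SameWindow b f a f d := by
  obtain ⟨a, d, h₁, h₂, h₃, h₄, -⟩ := exists_repeat (b + 2) s (fun t => shift t f)
    (fun t => shift t f)
  exact ⟨a, d, h₁, h₂, h₃, h₄.mono (by omega)⟩

/-- In a common extension, a long stretch between the two given blocks can be shortened. -/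
theorem Joins.shorten (hC : IsLocalClass C b) {f g h : ℕ → ℚ} {n k o N : ℕ} (hh : C h N)
    (hf : SameOrder f h n) (ho : o + k ≤ N) (hg : SameOrder g (shift o h) k)
    (hno : n + 4 ^ ((b + 2) * (b + 2)) + b ≤ o) : ∃ N' < N, Joins C f n g k N' := by
  obtain ⟨a, d, h₁, h₂, h₃, hw⟩ := exists_repeat_window b n h
  obtain ⟨x, hx, hx₁, hx₂⟩ := hC.cut hh h₂.le (by omega) hw
  refine ⟨N - (d - a), by omega, x, hx, ⟨0, by omega, ?_⟩, ⟨o - (d - a), by omega, ?_⟩⟩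
  · rw [shift_zero]
    exact hf.trans (hx₁.mono (by omega)).symm
  · have := hx₂.shift (o := o - d) (k := k) (by omega)
    rw [shift_shift, shift_shift, show a + (o - d) = o - (d - a) by omega,
      show d + (o - d) = o by omega] at this
    exact hg.trans this.symm

/-- Two sequences with a common extension have a short one. -/
theorem Joins.exists_short (hC : IsLocalClass C b) {f g : ℕ → ℚ} {n k N : ℕ}
    (h : Joins C f n g k N) : ∃ N' ≤ n + k + (4 ^ ((b + 2) * (b + 2)) + b), Joins C f n g k N' := by
  induction N using Nat.strong_induction_on with
  | _ N ih =>
    by_cases hN : N ≤ n + k + (4 ^ ((b + 2) * (b + 2)) + b)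
    · exact ⟨N, hN, h⟩
    · have hS : 0 < 4 ^ ((b + 2) * (b + 2)) := by positivity
      obtain ⟨x, hx, ⟨o, ho, hf⟩, ⟨o', ho', hg⟩⟩ := h
      -- Entries outside both blocks at either end can be dropped. Then one block is at the left end
      -- and the other one at the right end.
      by_cases hleft : 0 < o ∧ 0 < o'
      · refine ih (N - 1) (by omega) ⟨shift 1 x, hC.block hx (by omega),
          ⟨o - 1, by omega, ?_⟩, ⟨o' - 1, by omega, ?_⟩⟩
        · rwa [shift_shift, show 1 + (o - 1) = o by omega]
        · rwa [shift_shift, show 1 + (o' - 1) = o' by omega]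
      by_cases hright : o + n < N ∧ o' + k < N
      · exact ih (N - 1) (by omega) ⟨x, hC.take hx (by omega), ⟨o, by omega, hf⟩,
          ⟨o', by omega, hg⟩⟩
      rcases Nat.eq_zero_or_pos o with rfl | ho0
      · rw [shift_zero] at hf
        obtain ⟨N', hN', hj⟩ := Joins.shorten hC hx hf ho' hg (by omega)
        exact ih N' hN' hj
      · obtain rfl : o' = 0 := by omega
        rw [shift_zero] at hg
        obtain ⟨N', hN', hj⟩ := Joins.shorten hC hx hg ho hf (by omega)
        exact ih N' hN' hj.symm

namespace Reaches

variable {u v w f : ℕ → ℚ}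

theorem congr_left (h : Reaches C b u w) (huv : SameOrder u v b) : Reaches C b v w := by
  obtain ⟨x, c, h₁, h₂, h₃⟩ := h
  exact ⟨x, c, h₁, huv.symm.trans h₂, h₃⟩

theorem congr_right (h : Reaches C b w u) (huv : SameOrder u v b) : Reaches C b w v := by
  obtain ⟨x, c, h₁, h₂, h₃⟩ := h
  exact ⟨x, c, h₁, h₂, huv.symm.trans h₃⟩

theorem of_block (hC : IsLocalClass C b) {n i j : ℕ} (hf : C f n) (hij : i ≤ j) (hj : j + b ≤ n) :
    Reaches C b (shift i f) (shift j f) := by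
  refine ⟨shift i f, j - i, hC.block hf (by omega), SameOrder.refl _ _, ?_⟩
  rw [shift_shift, show i + (j - i) = j by omega]
  exact SameOrder.refl _ _

theorem trans (hC : IsLocalClass C b) (h₁ : Reaches C b u v) (h₂ : Reaches C b v w) :
    Reaches C b u w := by
  obtain ⟨x, c, hx, hx₁, hx₂⟩ := h₁
  obtain ⟨y, d, hy, hy₁, hy₂⟩ := h₂
  obtain ⟨z, hz, hz₁, hz₂⟩ := hC.splice (a := c) (c := d) le_rfl hx (by rwa [add_comm])
    (hx₂.symm.trans hy₁)
  refine ⟨z, c + d, by convert hz using 1; omega, hx₁.trans (hz₁.mono (by omega)).symm, ?_⟩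
  have := hz₂.shift (o := d) (k := b) (by omega)
  rw [shift_shift] at this
  exact hy₂.trans this.symm

/-- A sequence whose last window reaches the first window of another one can be joined to it. -/
theorem joins (hC : IsLocalClass C b) {f g : ℕ → ℚ} {a c : ℕ} (hf : C f (a + b)) (hg : C g (b + c))
    (h : Reaches C b (shift a f) g) : ∃ N, Joins C f (a + b) g (b + c) N := by
  obtain ⟨x, d, hx, hx₁, hx₂⟩ := h
  obtain ⟨y, hy, hy₁, hy₂⟩ := hC.splice (a := a) (c := d) le_rfl hf
    (by rwa [add_comm]) hx₁
  have hlast := hy₂.shift (o := d) (k := b) (by omega)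
  rw [shift_shift] at hlast
  obtain ⟨z, hz, hz₁, hz₂⟩ := hC.splice (a := a + d) (c := c) le_rfl (f := y) (g := g)
    (by convert hy using 1; omega) hg (hlast.trans hx₂.symm)
  refine ⟨_, z, hz, ⟨0, by omega, ?_⟩, ⟨a + d, by omega, hz₂.symm⟩⟩
  rw [shift_zero]
  exact hy₁.symm.trans (hz₁.mono (by omega)).symm

end Reaches

/-- Two overlapping sequences that agree on the overlap can be joined. -/
theorem IsLocalClass.joins_of_overlap (hC : IsLocalClass C b) {f g : ℕ → ℚ} {n k o : ℕ}
    (hf : C f n) (hg : C g k) (hk : o + b ≤ k)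
    (h : SameOrder (shift o g) f (min n (k - o))) : ∃ N, Joins C f n g k N := by
  by_cases hon : o + n ≤ k
  · exact ⟨k, g, hg, ⟨o, hon, (h.mono (by omega)).symm⟩, Embeds.refl g k⟩
  · obtain ⟨M, rfl⟩ : ∃ M, k = o + M := ⟨k - o, by omega⟩
    obtain ⟨c, rfl⟩ : ∃ c, n = M + c := ⟨n - M, by omega⟩
    obtain ⟨x, hx, hx₁, hx₂⟩ := hC.splice (a := o) (c := c) (by omega) hg hf (h.mono (by omega))
    refine ⟨_, x, hx, ⟨o, by omega, hx₂.symm⟩, ⟨0, by omega, ?_⟩⟩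
    rw [shift_zero]
    exact hx₁.symm

/-- Cutting out the part between two equal windows that have the same position relative to `i` and
`j` keeps the order of the entries at `i` and `j`. -/
theorem IsLocalClass.cut_keep (hC : IsLocalClass C b) {f : ℕ → ℚ} {n a d i j : ℕ} (hf : C f n)
    (had : a < d) (hdn : d + b ≤ n) (hin : i < n) (hjn : j < n) (hi : i < a ∨ d + b ≤ i)
    (hj : j < a ∨ d + b ≤ j)
    (hw : SameOrder (markedWindow b f (min i j) (max i j) a)
      (markedWindow b f (min i j) (max i j) d) (b + 2)) :
    ∃ h, C h (n - (d - a)) ∧ SameOrder h f (a + b) ∧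
      SameOrder (shift a h) (shift d f) (n - d) ∧
      (h (if i < a then i else i - (d - a)) < h (if j < a then j else j - (d - a)) ↔
        f i < f j) := by
  rcases hi with hi | hi <;> rcases hj with hj | hj
  · obtain ⟨h, h₁, h₂, h₃⟩ := hC.cut hf had.le hdn (SplitPair.window_eq hw)
    refine ⟨h, h₁, h₂, h₃, ?_⟩
    rw [if_pos hi, if_pos hj]
    exact h₂ i (by omega) j (by omega)
  · obtain ⟨x, rfl⟩ : ∃ x, j = d + x := ⟨j - d, by omega⟩
    obtain ⟨c, rfl⟩ : ∃ c, n = d + b + c := ⟨n - (d + b), by omega⟩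
    rw [min_eq_left (by omega), max_eq_right (by omega)] at hw
    obtain ⟨h, h₁, h₂, h₃, h₄⟩ := hC.splice_marked (a := a) (d := d) (c := c) hf (by omega) hi
      (by omega) (x := x) (by omega) (by omega) (by omega) hw
    refine ⟨h, by convert h₁ using 1; omega, h₂, by convert h₃ using 1; omega, ?_⟩
    rw [if_pos hi, if_neg (by omega), show d + x - (d - a) = a + x by omega]
    exact (h₄ i (by omega)).1
  · obtain ⟨x, rfl⟩ : ∃ x, i = d + x := ⟨i - d, by omega⟩
    obtain ⟨c, rfl⟩ : ∃ c, n = d + b + c := ⟨n - (d + b), by omega⟩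
    rw [min_eq_right (by omega), max_eq_left (by omega)] at hw
    obtain ⟨h, h₁, h₂, h₃, h₄⟩ := hC.splice_marked (a := a) (d := d) (c := c) hf (by omega) hj
      (by omega) (x := x) (by omega) (by omega) (by omega) hw
    refine ⟨h, by convert h₁ using 1; omega, h₂, by convert h₃ using 1; omega, ?_⟩
    rw [if_pos hj, if_neg (by omega), show d + x - (d - a) = a + x by omega]
    exact (h₄ j (by omega)).2
  · obtain ⟨h, h₁, h₂, h₃⟩ := hC.cut hf had.le hdn (SplitPair.window_eq hw)
    refine ⟨h, h₁, h₂, h₃, ?_⟩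
    rw [if_neg (by omega), if_neg (by omega)]
    have := h₃ (i - d) (by omega) (j - d) (by omega)
    simpa [show a + (i - d) = i - (d - a) by omega, show a + (j - d) = j - (d - a) by omega,
      show d + (i - d) = i by omega, show d + (j - d) = j by omega] using this

/-- Among four consecutive blocks of equal length, one contains none of three given positions. -/
theorem exists_free_block {W : ℕ} (hW : 0 < W) (x y z : ℕ) :
    ∃ s, s + W ≤ 4 * W ∧ (x < s ∨ s + W ≤ x) ∧ (y < s ∨ s + W ≤ y) ∧ (z < s ∨ s + W ≤ z) := by
  obtain ⟨r, hr, h₁, h₂, h₃⟩ : ∃ r < 4, r ≠ x / W ∧ r ≠ y / W ∧ r ≠ z / W := by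
    by_contra! hcon
    have h0 := hcon 0
    have h1 := hcon 1
    have h2 := hcon 2
    have h3 := hcon 3
    omega
  have key : ∀ x, r ≠ x / W → x < r * W ∨ r * W + W ≤ x := by
    intro x hx
    rcases lt_or_gt_of_ne hx with h | h
    · right
      have : (r + 1) * W ≤ x := (Nat.le_div_iff_mul_le hW).1 h
      rwa [add_mul, one_mul] at this
    · left
      exact (Nat.div_lt_iff_lt_mul hW).1 h
  refine ⟨r * W, ?_, key x h₁, key y h₂, key z h₃⟩
  have : (r + 1) * W ≤ 4 * W := Nat.mul_le_mul_right W (by omega)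
  rwa [add_mul, one_mul] at this

/-- Two members of the class that leave the set of windows from which `s` can be reached at the
same position, and that differ on the positions they have in common. -/
structure Clash (C : (ℕ → ℚ) → ℕ → Prop) (b : ℕ) (s : ℕ → ℚ) (e : ℕ) (f : ℕ → ℚ) (n : ℕ)
    (g : ℕ → ℚ) (k : ℕ) : Prop where
  left : C f n
  right : C g k
  le_left : e + 1 + b ≤ n
  le_right : e + 1 + b ≤ k
  reaches_left : Reaches C b (shift e f) s
  not_reaches_left : ¬ Reaches C b (shift (e + 1) f) s
  reaches_right : Reaches C b (shift e g) s
  not_reaches_right : ¬ Reaches C b (shift (e + 1) g) s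
  differ : ¬ SameOrder f g (min n k)

namespace Clash

variable {s f g : ℕ → ℚ} {e n k : ℕ}

theorem symm (h : Clash C b s e f n g k) : Clash C b s e g k f n :=
  ⟨h.right, h.left, h.le_right, h.le_left, h.reaches_right, h.not_reaches_right, h.reaches_left,
    h.not_reaches_left, fun hs => h.differ (by rw [min_comm]; exact hs.symm)⟩

/-- A common extension would leave the set of windows that reach `s` at one position only, so that
the two sequences would have to be placed at the same position. -/
theorem not_joins (hC : IsLocalClass C b) (h : Clash C b s e f n g k) {N : ℕ} :
    ¬ Joins C f n g k N := by
  rintro ⟨x, hx, ⟨o, ho, hf⟩, ⟨o', ho', hg⟩⟩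
  have hfe : ∀ i ≤ e + 1, SameWindow b f i x (o + i) := by
    intro i hi
    have := hf.shift (o := i) (k := b) (by have := h.le_left; omega)
    rwa [shift_shift] at this
  have hge : ∀ i ≤ e + 1, SameWindow b g i x (o' + i) := by
    intro i hi
    have := hg.shift (o := i) (k := b) (by have := h.le_right; omega)
    rwa [shift_shift] at this
  have hle := h.le_left
  have hre := h.le_right
  rcases lt_trichotomy o o' with hlt | rfl | hlt
  · refine h.not_reaches_left (Reaches.congr_left ?_ (hfe (e + 1) le_rfl).symm)
    exact (Reaches.of_block hC hx (j := o' + e) (by omega) (by omega)).trans hC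
      (h.reaches_right.congr_left (hge e (by omega)))
  · exact h.differ ((hf.mono (by omega)).trans (hg.mono (by omega)).symm)
  · refine h.not_reaches_right (Reaches.congr_left ?_ (hge (e + 1) le_rfl).symm)
    exact (Reaches.of_block hC hx (j := o + e) (by omega) (by omega)).trans hC
      (h.reaches_left.congr_left (hfe e (by omega)))

/-- If the clashing sequences overlap in a long stretch, they can both be shortened. -/
theorem shorten_both (hC : IsLocalClass C b) (h : Clash C b s e f n g k)
    (hn : 4 * (4 ^ ((b + 2) * (b + 2)) + b + 1) ≤ n)
    (hk : 4 * (4 ^ ((b + 2) * (b + 2)) + b + 1) ≤ k) :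
    ∃ e' f' n' g' k', n' + k' < n + k ∧ Clash C b s e' f' n' g' k' := by
  obtain ⟨i, hi, j, hj, hij⟩ : ∃ i < min n k, ∃ j < min n k, ¬ (f i < f j ↔ g i < g j) := by
    by_contra! hcon
    exact h.differ fun i hi j hj => hcon i hi j hj
  -- The part to be cut out avoids the exit position `e` and a pair `i, j` on which the sequences
  -- differ.
  obtain ⟨t, ht, hte, hti, htj⟩ := exists_free_block
    (W := 4 ^ ((b + 2) * (b + 2)) + b + 1) (Nat.succ_pos _) e i j
  obtain ⟨a, d, h₁, h₂, h₃, hwf, hwg⟩ := ConsecPerm.exists_repeat (b + 2) t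
    (fun a => markedWindow b f (min i j) (max i j) a)
    (fun a => markedWindow b g (min i j) (max i j) a)
  obtain ⟨f', hf, hf₁, hf₂, hf₃⟩ := hC.cut_keep (a := a) (d := d) (i := i) (j := j) h.left h₂
    (by omega) (by omega) (by omega) (by omega) (by omega) hwf
  obtain ⟨g', hg, hg₁, hg₂, hg₃⟩ := hC.cut_keep (a := a) (d := d) (i := i) (j := j) h.right h₂
    (by omega) (by omega) (by omega) (by omega) (by omega) hwg
  have hle := h.le_left
  have hre := h.le_right
  have hwin : ∀ (f f' : ℕ → ℚ) (n : ℕ), d + b ≤ n → e + 1 + b ≤ n → SameOrder f' f (a + b) →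
      SameOrder (shift a f') (shift d f) (n - d) →
      SameWindow b f (e) f' (if e < a then e else e - (d - a)) ∧
      SameWindow b f (e + 1) f' ((if e < a then e else e - (d - a)) + 1) := by
    intro f f' n hdn hen h₁ h₂
    by_cases hea : e < a
    · rw [if_pos hea]
      exact ⟨(h₁.shift (by omega)).symm, (h₁.shift (by omega)).symm⟩
    · rw [if_neg hea]
      have e₁ := h₂.shift (o := e - d) (k := b) (by omega)
      have e₂ := h₂.shift (o := e + 1 - d) (k := b) (by omega)
      rw [shift_shift, shift_shift, show a + (e - d) = e - (d - a) by omega,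
        show d + (e - d) = e by omega] at e₁
      rw [shift_shift, shift_shift, show a + (e + 1 - d) = e - (d - a) + 1 by omega,
        show d + (e + 1 - d) = e + 1 by omega] at e₂
      exact ⟨e₁.symm, e₂.symm⟩
  obtain ⟨f₀, f₁⟩ := hwin f f' n (by omega) (by omega) hf₁ hf₂
  obtain ⟨g₀, g₁⟩ := hwin g g' k (by omega) (by omega) hg₁ hg₂
  have he' : (if e < a then e else e - (d - a)) + 1 + b ≤ min (n - (d - a)) (k - (d - a)) := by
    split_ifs <;> omega
  refine ⟨if e < a then e else e - (d - a), f', n - (d - a), g', k - (d - a), by omega,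
    hf, hg, by omega, by omega, h.reaches_left.congr_left f₀,
    fun hc => h.not_reaches_left (hc.congr_left f₁.symm), h.reaches_right.congr_left g₀,
    fun hc => h.not_reaches_right (hc.congr_left g₁.symm), fun hs => hij ?_⟩
  rw [← hf₃, ← hg₃]
  exact hs _ (by split_ifs <;> omega) _ (by split_ifs <;> omega)

/-- If one of the clashing sequences is much longer than the other, it can be shortened. -/
theorem shorten_right (hC : IsLocalClass C b) (h : Clash C b s e f n g k) {W : ℕ}
    (hW : 4 ^ ((b + 2) * (b + 2)) + b + 1 = W) (hn : n < 4 * W) (hk : 8 * W ≤ k) :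
    ∃ g' k', k' < k ∧ Clash C b s e f n g' k' := by
  obtain ⟨a, d, h₁, h₂, h₃, hw⟩ := exists_repeat_window b (4 * W) g
  have hS : 0 < 4 ^ ((b + 2) * (b + 2)) := by positivity
  obtain ⟨g', hg, hg₁, hg₂⟩ := hC.cut h.right h₂.le (by omega) hw
  have hle := h.le_left
  have hwin : ∀ i ≤ e + 1, SameWindow b g i g' i := fun i hi => (hg₁.shift (by omega)).symm
  refine ⟨g', k - (d - a), by omega, h.left, hg, hle, by omega, h.reaches_left,
    h.not_reaches_left, h.reaches_right.congr_left (hwin e (by omega)),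
    fun hc => h.not_reaches_right (hc.congr_left (hwin (e + 1) le_rfl).symm), fun hs => ?_⟩
  exact h.differ ((hs.mono (by omega)).trans (hg₁.mono (by omega)))

/-- If both sequences are long, they are shortened together; otherwise only the longer one is. -/
theorem exists_short (hC : IsLocalClass C b) (h : Clash C b s e f n g k) :
    ∃ e' f' n' g' k', n' < 8 * (4 ^ ((b + 2) * (b + 2)) + b + 1) ∧
      k' < 8 * (4 ^ ((b + 2) * (b + 2)) + b + 1) ∧ Clash C b s e' f' n' g' k' := by
  generalize hN : n + k = N
  induction N using Nat.strong_induction_on generalizing e f n g k with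
  | _ N ih =>
    by_cases hn : n < 8 * (4 ^ ((b + 2) * (b + 2)) + b + 1)
    · by_cases hk : k < 8 * (4 ^ ((b + 2) * (b + 2)) + b + 1)
      · exact ⟨e, f, n, g, k, hn, hk, h⟩
      · by_cases hn' : n < 4 * (4 ^ ((b + 2) * (b + 2)) + b + 1)
        · obtain ⟨g', k', hk', h'⟩ := h.shorten_right hC rfl hn' (by omega)
          exact ih (n + k') (by omega) h' rfl
        · obtain ⟨e', f', n', g', k', hlt, h'⟩ := h.shorten_both hC (by omega) (by omega)
          exact ih (n' + k') (by omega) h' rfl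
    · by_cases hk' : k < 4 * (4 ^ ((b + 2) * (b + 2)) + b + 1)
      · obtain ⟨f', n', hn', h'⟩ := h.symm.shorten_right hC rfl hk' (by omega)
        exact ih (n' + k) (by omega) h'.symm rfl
      · obtain ⟨e', f', n', g', k', hlt, h'⟩ := h.shorten_both hC (by omega) (by omega)
        exact ih (n' + k') (by omega) h' rfl

end Clash

theorem exists_exit {P : ℕ → Prop} {a : ℕ} (h0 : P 0) (ha : ¬ P a) :
    ∃ e < a, P e ∧ ¬ P (e + 1) := by
  by_contra! hcon
  have : ∀ i ≤ a, P i := by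
    intro i
    induction i with
    | zero => exact fun _ => h0
    | succ i ih => exact fun hi => hcon i (by omega) (ih (by omega))
  exact ha (this a le_rfl)

/-- If short sequences can be joined, then two sequences such that the first window of the second
can be reached from that of the first can be joined. -/
theorem joins_of_reaches (hC : IsLocalClass C b)
    (hshort : ∀ f n g k, n ≤ 8 * (4 ^ ((b + 2) * (b + 2)) + b + 1) →
      k ≤ 8 * (4 ^ ((b + 2) * (b + 2)) + b + 1) → C f n → C g k → ∃ N, Joins C f n g k N)
    {f g : ℕ → ℚ} {a c : ℕ} (hf : C f (a + b)) (hg : C g (c + b)) (hfg : Reaches C b f g) :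
    ∃ N, Joins C f (a + b) g (c + b) N := by
  by_contra hno
  -- The last window of either sequence does not reach the first window of the other one, as
  -- otherwise the two sequences could be concatenated.
  have hf₁ : ¬ Reaches C b (shift a f) g := fun h =>
    hno (by
      obtain ⟨N, hN⟩ := h.joins hC hf (c := c) (by rwa [add_comm])
      exact ⟨N, by rwa [add_comm c b]⟩)
  have hg₁ : ¬ Reaches C b (shift c g) f := fun h =>
    hno (by
      obtain ⟨N, hN⟩ := h.joins hC hg (c := a) (by rwa [add_comm])
      exact ⟨N, by rw [add_comm a b]; exact hN.symm⟩)
  have hf₂ : ¬ Reaches C b (shift a f) f := fun h => hf₁ (h.trans hC hfg)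
  obtain ⟨x, d, hx, hx₁, hx₂⟩ := hfg
  -- `y` begins with the first window of `f` and ends with `g`.
  obtain ⟨y, hy, hy₁, hy₂⟩ := hC.splice (a := d) (c := c) le_rfl hx
    (by rwa [add_comm]) hx₂.symm
  have hgy : Embeds g (c + b) y (d + b + c) :=
    ⟨d, by omega, (hy₂.mono (by omega)).symm⟩
  have hylast : SameWindow b y (d + c) g c := by
    have := hy₂.shift (o := c) (k := b) (by omega)
    rwa [shift_shift] at this
  have hff : Reaches C b f f := by
    simpa using Reaches.of_block hC hf (i := 0) (j := 0) le_rfl (by omega)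
  obtain ⟨e, hea, he, he'⟩ := exists_exit (P := fun i => Reaches C b (shift i f) f) (a := a)
    (by simpa using hff) hf₂
  obtain ⟨e₂, hea₂, he₂, he₂'⟩ := exists_exit (P := fun i => Reaches C b (shift i y) f)
    (a := d + c)
    (by
      rw [shift_zero]
      exact hff.congr_left (hx₁.trans (hy₁.mono (by omega)).symm))
    (fun h => hg₁ (h.congr_left hylast))
  have hnoy : ∀ N, ¬ Joins C f (a + b) y (d + b + c) N := fun N hN =>
    hno ⟨N, hN.mono (Embeds.refl _ _) hgy⟩
  have hclash : ∀ s e f n g k, Clash C b s e f n g k → False := by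
    intro s e f n g k h
    obtain ⟨e', f', n', g', k', hn', hk', h'⟩ := h.exists_short hC
    obtain ⟨N, hN⟩ := hshort f' n' g' k' hn'.le hk'.le h'.left h'.right
    exact h'.not_joins hC hN
  -- Drop the initial part of the sequence with the later exit, so that both exit at the same
  -- position. If they agree on the positions they have in common, they can be joined.
  rcases le_total e e₂ with hle | hle
  · obtain ⟨o, rfl⟩ : ∃ o, e₂ = o + e := ⟨e₂ - e, by omega⟩
    refine hclash f e f (a + b) (shift o y) (d + b + c - o)
      ⟨hf, hC.block hy (by omega), by omega, by omega, he, he', ?_, ?_, fun hs => ?_⟩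
    · rwa [shift_shift]
    · rwa [shift_shift, ← add_assoc]
    · obtain ⟨N, hN⟩ := hC.joins_of_overlap hf hy (o := o) (by omega) hs.symm
      exact hnoy N hN
  · obtain ⟨o, rfl⟩ : ∃ o, e = o + e₂ := ⟨e - e₂, by omega⟩
    refine hclash f e₂ y (d + b + c) (shift o f) (a + b - o)
      ⟨hy, hC.block hf (by omega), by omega, by omega, he₂, he₂', ?_, ?_, fun hs => ?_⟩
    · rwa [shift_shift]
    · rwa [shift_shift, ← add_assoc]
    · obtain ⟨N, hN⟩ := hC.joins_of_overlap hy hf (o := o) (by omega) hs.symm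
      exact hnoy N hN.symm

/-- Joint embeddings exist as soon as they exist for sequences of bounded length. -/
theorem joins_of_short (hC : IsLocalClass C b)
    (hshort : ∀ f n g k, n ≤ 8 * (4 ^ ((b + 2) * (b + 2)) + b + 1) →
      k ≤ 8 * (4 ^ ((b + 2) * (b + 2)) + b + 1) → C f n → C g k → ∃ N, Joins C f n g k N)
    {f g : ℕ → ℚ} {n k : ℕ} (hf : C f n) (hg : C g k) : ∃ N, Joins C f n g k N := by
  have hS : 0 < 4 ^ ((b + 2) * (b + 2)) := by positivity
  have hlong : ∀ f n g k, b ≤ n → b ≤ k → C f n → C g k → ∃ N, Joins C f n g k N := by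
    intro f n g k hn hk hf hg
    obtain ⟨a, rfl⟩ : ∃ a, n = a + b := ⟨n - b, by omega⟩
    obtain ⟨c, rfl⟩ : ∃ c, k = c + b := ⟨k - b, by omega⟩
    obtain ⟨N, x, hx, ⟨o, ho, hfx⟩, ⟨o', ho', hgx⟩⟩ := hshort f b g b (by omega) (by omega)
      (hC.take hf (by omega)) (hC.take hg (by omega))
    rcases le_total o o' with hle | hle
    · exact joins_of_reaches hC hshort hf hg (((Reaches.of_block hC hx hle ho').congr_left
        hfx.symm).congr_right hgx.symm)
    · obtain ⟨N, hN⟩ := joins_of_reaches hC hshort hg hf (((Reaches.of_block hC hx hle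
        ho).congr_left hgx.symm).congr_right hfx.symm)
      exact ⟨N, hN.symm⟩
  by_cases hnk : n < b ∧ k < b
  · exact hshort f n g k (by omega) (by omega) hf hg
  -- A short sequence is first extended by means of some member of length `b`.
  obtain ⟨u, hu⟩ : ∃ u, C u b := by
    by_cases hn : n < b
    · exact ⟨g, hC.take hg (by omega)⟩
    · exact ⟨f, hC.take hf (by omega)⟩
  have hext : ∀ f n, C f n → ∃ f' n', b ≤ n' ∧ C f' n' ∧ Embeds f n f' n' := by
    intro f n hf
    rcases le_or_gt b n with hn | hn
    · exact ⟨f, n, hn, hf, Embeds.refl f n⟩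
    · obtain ⟨N, x, hx, h₁, ⟨o, ho, -⟩⟩ := hshort f n u b (by omega) (by omega) hf hu
      exact ⟨x, N, by omega, hx, h₁⟩
  obtain ⟨f', n', hn', hf', hff'⟩ := hext f n hf
  obtain ⟨g', k', hk', hg', hgg'⟩ := hext g k hg
  obtain ⟨N, hN⟩ := hlong f' n' g' k' hn' hk' hf' hg'
  exact ⟨N, hN.mono hff' hgg'⟩

end Joint

/-! ### Permutations as sequences of rationals -/

/-- The entries of a list as rational numbers. -/
def entries (l : List ℕ) : ℕ → ℚ := fun i => (l.getD i 0 : ℚ)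

theorem entries_lt {l l' : List ℕ} {i j : ℕ} :
    entries l i < entries l' j ↔ l.getD i 0 < l'.getD j 0 := by
  simp [entries]

theorem IsPermutation.inj {l : List ℕ} (h : IsPermutation l) : Inj (entries l) l.length := by
  intro i hi j hj hij
  have : l.getD i 0 = l.getD j 0 := by simpa [entries] using hij
  rw [List.getD_eq_getElem _ _ hi, List.getD_eq_getElem _ _ hj] at this
  exact h.nodup.getElem_inj_iff.1 this

theorem le_iff_embeds {σ τ : Permutation} :
    σ ≤ τ ↔ Embeds (entries σ.1) σ.1.length (entries τ.1) τ.1.length := by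
  constructor
  · rintro ⟨s, ⟨u, v, huv⟩, hlen, hs⟩
    have hτ : τ.1.length = u.length + s.length + v.length := by
      rw [← huv]; simp [add_assoc]
    have key : ∀ k, k < s.length → τ.1.getD (u.length + k) 0 = s.getD k 0 := by
      intro k hk
      rw [← huv]
      simp [List.getD_eq_getElem?_getD, List.getElem?_append, hk]
    refine ⟨u.length, by omega, fun i hi j hj => ?_⟩
    rw [shift_apply, shift_apply, entries_lt, entries_lt, key i (by omega), key j (by omega),
      ← not_le, ← not_le]
    exact (not_congr (hs j i (by omega) (by omega))).symm
  · rintro ⟨o, ho, hs⟩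
    refine ⟨(τ.1.drop o).take σ.1.length,
      (List.take_prefix _ _).isInfix.trans (List.drop_suffix _ _).isInfix, ?_, ?_⟩
    · simp only [List.length_take, List.length_drop]
      omega
    · intro i j hi hj
      simp only [List.length_take, List.length_drop, lt_min_iff] at hi hj
      have key : ∀ k, k < σ.1.length →
          ((τ.1.drop o).take σ.1.length).getD k 0 = τ.1.getD (o + k) 0 := by
        intro k hk
        simp [List.getD_eq_getElem?_getD, hk]
      have := hs j hj.1 i hi.1
      rw [shift_apply, shift_apply, entries_lt, entries_lt] at this
      rw [key i hi.1, key j hj.1, ← not_lt, ← not_lt]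
      exact (not_congr this).symm

/-- Every finite sequence of distinct rationals is order isomorphic to a permutation. -/
theorem exists_permutation {f : ℕ → ℚ} {n : ℕ} (hf : Inj f n) :
    ∃ σ : Permutation, σ.1.length = n ∧ SameOrder (entries σ.1) f n := by
  -- Each entry is replaced by its rank.
  let rank : ℕ → ℕ := fun i => ((Finset.range n).filter fun j => f j ≤ f i).card
  have hrank : ∀ i < n, ∀ j < n, (rank i < rank j ↔ f i < f j) := by
    intro i hi j hj
    have hmono : ∀ i < n, ∀ j < n, f i < f j → rank i < rank j := by
      intro i hi j hj hlt
      refine Finset.card_lt_card ⟨fun x hx => ?_, fun hsub => ?_⟩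
      · rw [Finset.mem_filter] at hx ⊢
        exact ⟨hx.1, hx.2.trans hlt.le⟩
      · have := hsub (Finset.mem_filter.2 ⟨Finset.mem_range.2 hj, le_rfl⟩)
        rw [Finset.mem_filter] at this
        exact absurd hlt (not_lt.2 this.2)
    refine ⟨fun h => ?_, hmono i hi j hj⟩
    rcases lt_trichotomy (f i) (f j) with h' | h' | h'
    · exact h'
    · rw [hf i hi j hj h'] at h
      exact absurd h (lt_irrefl _)
    · exact absurd h (hmono j hj i hi h').asymm
  have hinj : ∀ i < n, ∀ j < n, rank i = rank j → i = j := by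
    intro i hi j hj h
    by_contra hne
    rcases lt_or_gt_of_ne (fun e => hne (hf i hi j hj e)) with h' | h'
    · exact absurd h ((hrank i hi j hj).2 h').ne
    · exact absurd h ((hrank j hj i hi).2 h').ne'
  have hmem : ∀ i < n, rank i ∈ Finset.Icc 1 n := by
    intro i hi
    rw [Finset.mem_Icc]
    constructor
    · exact Finset.card_pos.2 ⟨i, Finset.mem_filter.2 ⟨Finset.mem_range.2 hi, le_rfl⟩⟩
    · exact (Finset.card_filter_le _ _).trans (by simp)
  have himg : (Finset.range n).image rank = Finset.Icc 1 n := by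
    refine Finset.eq_of_subset_of_card_le (fun x hx => ?_) ?_
    · obtain ⟨i, hi, rfl⟩ := Finset.mem_image.1 hx
      exact hmem i (Finset.mem_range.1 hi)
    · rw [Finset.card_image_of_injOn]
      · simp
      · intro i hi j hj hij
        simp only [Finset.coe_range, Set.mem_Iio] at hi hj
        exact hinj i hi j hj hij
  have hnodup : ((List.range n).map rank).Nodup := by
    refine List.Nodup.map_on ?_ List.nodup_range
    intro i hi j hj hij
    exact hinj i (List.mem_range.1 hi) j (List.mem_range.1 hj) hij
  have hperm : IsPermutation ((List.range n).map rank) := by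
    constructor
    · intro a ha
      obtain ⟨i, hi, rfl⟩ := List.mem_map.1 ha
      have := hmem i (List.mem_range.1 hi)
      rw [Finset.mem_Icc] at this
      simpa using this
    · intro k hk hk'
      refine List.count_eq_one_of_mem hnodup ?_
      have : k ∈ (Finset.range n).image rank := by
        rw [himg, Finset.mem_Icc]
        exact ⟨hk, by simpa using hk'⟩
      simpa using this
  refine ⟨⟨_, hperm⟩, by simp, fun i hi j hj => ?_⟩
  have key : ∀ k < n, ((List.range n).map rank).getD k 0 = rank k := by
    intro k hk
    simp [List.getD_eq_getElem?_getD, hk]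
  rw [entries_lt, key i hi, key j hj, hrank i hi j hj]

/-- The sequences order isomorphic to permutations that avoid the permutations in `B`. -/
def avoiders (B : List Permutation) (f : ℕ → ℚ) (n : ℕ) : Prop :=
  Inj f n ∧ ∀ β ∈ B, ¬ Embeds (entries β.1) β.1.length f n

/-- A number that exceeds the lengths of all permutations in `B`: their total length plus one. -/
def windowLength (B : List Permutation) : ℕ := (B.map fun β => β.1).flatten.length + 1

theorem length_lt_windowLength {B : List Permutation} {β : Permutation} (h : β ∈ B) :
    β.1.length < windowLength B := by
  have := (List.sublist_flatten_of_mem (List.mem_map_of_mem (f := fun β : Permutation => β.1)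
    h)).length_le
  exact Nat.lt_succ_of_le this

theorem isLocalClass_avoiders (B : List Permutation) :
    IsLocalClass (avoiders B) (windowLength B) where
  pos := Nat.succ_pos _
  inj := fun h => h.1
  block := fun h hk => ⟨h.1.shift hk, fun β hβ he => h.2 β hβ (he.trans (Embeds.block hk))⟩
  congr := by
    intro f g n h hf
    refine ⟨h.inj hf.1, fun β hβ he => hf.2 β hβ (he.trans ⟨0, by omega, ?_⟩)⟩
    rw [shift_zero]
    exact h.symm
  of_windows := by
    intro f n hn hf h
    refine ⟨hf, ?_⟩
    rintro β hβ ⟨o, ho, hs⟩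
    have hlen := length_lt_windowLength hβ
    -- An occurrence of `β` lies within some window.
    obtain ⟨w, x, hw, rfl, hx⟩ : ∃ w x, w + windowLength B ≤ n ∧ o = w + x ∧
        x + β.1.length ≤ windowLength B :=
      ⟨min o (n - windowLength B), o - min o (n - windowLength B), by omega, by omega, by omega⟩
    refine (h w hw).2 β hβ ⟨x, hx, ?_⟩
    rwa [shift_shift]

theorem mem_Av_iff {B : List Permutation} {σ : Permutation} :
    σ ∈ Av {β | β ∈ B} ↔ avoiders B (entries σ.1) σ.1.length := by
  simp only [Av, avoiders, Set.mem_ofPred_eq, le_iff_embeds]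
  exact ⟨fun h => ⟨σ.2.inj, h⟩, fun h => h.2⟩

/-- Members of the class of avoiders are, up to order isomorphism, the permutations in `Av B`. -/
theorem exists_mem_Av {B : List Permutation} {f : ℕ → ℚ} {n : ℕ} (hf : avoiders B f n) :
    ∃ σ ∈ Av {β | β ∈ B}, σ.1.length = n ∧ SameOrder (entries σ.1) f n := by
  obtain ⟨σ, hσ, hs⟩ := exists_permutation hf.1
  refine ⟨σ, mem_Av_iff.2 ?_, hσ, hs⟩
  rw [hσ]
  exact (isLocalClass_avoiders B).congr hs.symm hf

theorem Embeds.congr {f f' g g' : ℕ → ℚ} {n k : ℕ} (h : Embeds f n g k) (hf : SameOrder f' f n)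
    (hg : SameOrder g g' k) : Embeds f' n g' k := by
  obtain ⟨o, ho, hs⟩ := h
  exact ⟨o, ho, hf.trans (hs.trans (hg.shift ho))⟩

/-! ### Atomic sets and well quasi-ordered sets -/

/-- A downward closed set is atomic if and only if any two of its elements have a common upper bound
in it. -/
theorem atomic_iff {α : Type*} [PartialOrder α] {C : Set α} (hC : IsLowerSet C) :
    Atomic C ↔ ∀ x ∈ C, ∀ y ∈ C, ∃ z ∈ C, x ≤ z ∧ y ≤ z := by
  constructor
  · intro h x hx y hy
    by_contra! hno
    refine h ⟨{z ∈ C | ¬ x ≤ z}, {z ∈ C | ¬ y ≤ z}, ?_, ?_, ?_, ?_, ?_⟩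
    · exact fun a b hba ha => ⟨hC hba ha.1, fun hxb => ha.2 (hxb.trans hba)⟩
    · exact fun a b hba ha => ⟨hC hba ha.1, fun hxb => ha.2 (hxb.trans hba)⟩
    · exact ⟨fun z hz => hz.1, fun hsub => (hsub hx).2 le_rfl⟩
    · exact ⟨fun z hz => hz.1, fun hsub => (hsub hy).2 le_rfl⟩
    · ext z
      constructor
      · intro hz
        by_cases hxz : x ≤ z
        · exact Or.inr ⟨hz, hno z hz hxz⟩
        · exact Or.inl ⟨hz, hxz⟩
      · rintro (hz | hz) <;> exact hz.1
  · rintro h ⟨D, E, hD, hE, hDC, hEC, hU⟩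
    obtain ⟨x, hx, hxD⟩ := Set.exists_of_ssubset hDC
    obtain ⟨y, hy, hyE⟩ := Set.exists_of_ssubset hEC
    obtain ⟨z, hz, hxz, hyz⟩ := h x hx y hy
    rw [hU] at hz
    rcases hz with hz | hz
    · exact hxD (hD hxz hz)
    · exact hyE (hE hyz hz)

theorem isLowerSet_Av {α : Type*} [PartialOrder α] (B : Set α) : IsLowerSet (Av B) :=
  fun _ _ hba ha β hβ hβb => ha β hβ (hβb.trans hba)

theorem length_le_of_le {σ τ : Permutation} (h : σ ≤ τ) : σ.1.length ≤ τ.1.length := by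
  obtain ⟨o, ho, -⟩ := le_iff_embeds.1 h
  omega

theorem length_lt_of_lt {σ τ : Permutation} (h : σ < τ) : σ.1.length < τ.1.length := by
  obtain ⟨o, ho, hs⟩ := le_iff_embeds.1 h.le
  by_contra hnot
  obtain rfl : o = 0 := by omega
  rw [shift_zero] at hs
  refine h.not_ge (le_iff_embeds.2 ⟨0, by omega, ?_⟩)
  rw [shift_zero]
  exact (hs.mono (by omega)).symm

/-- All lists of length at most `k` with entries at most `n`. -/
def boundedLists (n k : ℕ) : List (List ℕ) :=
  Nat.rec [[]] (fun _ L => [] :: L.flatMap fun l => (List.range (n + 1)).map fun a => a :: l) k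

theorem mem_boundedLists {n k : ℕ} {l : List ℕ} (hl : l.length ≤ k) (hn : ∀ a ∈ l, a ≤ n) :
    l ∈ boundedLists n k := by
  induction k generalizing l with
  | zero =>
    obtain rfl : l = [] := List.length_eq_zero_iff.1 (by omega)
    simp [boundedLists]
  | succ k ih =>
    have e : boundedLists n (k + 1) = [] :: (boundedLists n k).flatMap fun l =>
      (List.range (n + 1)).map fun a => a :: l := rfl
    rw [e]
    cases l with
    | nil => simp
    | cons a l =>
      refine List.mem_cons_of_mem _ (List.mem_flatMap.2 ⟨l, ih ?_ ?_, ?_⟩)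
      · simpa using hl
      · exact fun a ha => hn a (List.mem_cons_of_mem _ ha)
      · have := hn a List.mem_cons_self
        simp only [List.mem_map, List.mem_range]
        exact ⟨a, by omega, rfl⟩

theorem Permutation.mem_boundedLists {σ : Permutation} {k : ℕ} (h : σ.1.length ≤ k) :
    σ.1 ∈ boundedLists k k :=
  ConsecPerm.mem_boundedLists h fun a ha => (σ.2.1 a ha).2.trans h

theorem finite_length_le (k : ℕ) : {σ : Permutation | σ.1.length ≤ k}.Finite := by
  refine Set.Finite.of_finite_image (f := fun σ : Permutation => σ.1)
    ((List.finite_toSet (boundedLists k k)).subset ?_) (Subtype.val_injective.injOn)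
  rintro l ⟨σ, hσ, rfl⟩
  exact Permutation.mem_boundedLists hσ

/-- The length of the windows used for deciding well quasi-order. -/
def splitLength (b : ℕ) : ℕ := 4 ^ ((b + 2) * (b + 2)) + b + 1

theorem wqo_Av_iff (B : List Permutation) :
    WQO (Av {β | β ∈ B}) ↔
      ¬ HasObstruction (avoiders B) (windowLength B) (splitLength (windowLength B)) := by
  have hC := isLocalClass_avoiders B
  constructor
  · rintro ⟨-, hanti⟩ hobs
    obtain ⟨n, τ, hτ, hn, hemb⟩ := hobs.hasAntichain hC le_rfl
    have hσ := fun k => exists_mem_Av (hτ k)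
    choose σ hσA hσn hσs using hσ
    have hinj : Function.Injective σ := by
      intro i j hij
      exact hn.injective (by rw [← hσn i, ← hσn j, hij])
    have hlt : ∀ k m, k < m → ¬ σ k ≤ σ m := by
      intro k m hkm hle
      have := le_iff_embeds.1 hle
      rw [hσn, hσn] at this
      exact hemb k m hkm (this.congr (hσs k).symm (hσs m))
    refine Set.infinite_range_of_injective hinj
      (hanti (Set.range σ) (Set.range_subset_iff.2 hσA) ?_)
    rintro _ ⟨k, rfl⟩ _ ⟨m, rfl⟩ hne hle
    rcases lt_trichotomy k m with h | rfl | h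
    · exact hlt k m h hle
    · exact hne rfl
    · have h₁ := length_le_of_le hle
      rw [hσn, hσn] at h₁
      exact absurd (hn h) (not_lt.2 h₁)
  · intro hno
    constructor
    · refine Set.WellFoundedOn.mono' (r' := fun σ τ : Permutation => σ < τ)
        (fun _ _ _ _ h => h) ?_
      refine WellFounded.wellFoundedOn (Subrelation.wf (fun h => length_lt_of_lt h)
        (InvImage.wf (fun σ : Permutation => σ.1.length) Nat.lt_wfRel.wf))
    · intro A hA hAnti
      by_contra hinf
      have hinf' : (A \ {σ : Permutation | σ.1.length ≤ 4 ^ (splitLength (windowLength B) *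
          splitLength (windowLength B)) + splitLength (windowLength B)}).Infinite :=
        Set.Infinite.sdiff hinf (finite_length_le _)
      have := hinf'.to_subtype
      let e := Infinite.natEmbedding
        (A \ {σ : Permutation | σ.1.length ≤ 4 ^ (splitLength (windowLength B) *
          splitLength (windowLength B)) + splitLength (windowLength B)} : Set Permutation)
      obtain ⟨i, j, hij, hem⟩ := exists_embeds_of_not_hasObstruction hC rfl hno
        (fun k => (e k).1.1.length) (fun k => entries (e k).1.1)
        (fun k => mem_Av_iff.1 (hA (e k).2.1)) (fun k => (not_le.1 (e k).2.2).le)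
      refine hAnti (e i).2.1 (e j).2.1 ?_ (le_iff_embeds.2 hem)
      intro he
      exact hij.ne (e.injective (Subtype.ext he))

theorem atomic_Av_iff (B : List Permutation) :
    Atomic (Av {β | β ∈ B}) ↔
      ∀ σ ∈ Av {β | β ∈ B}, σ.1.length ≤ 8 * splitLength (windowLength B) →
      ∀ τ ∈ Av {β | β ∈ B}, τ.1.length ≤ 8 * splitLength (windowLength B) →
      ∃ ρ ∈ Av {β | β ∈ B}, ρ.1.length ≤ 17 * splitLength (windowLength B) ∧ σ ≤ ρ ∧ τ ≤ ρ := by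
  have hC := isLocalClass_avoiders B
  rw [atomic_iff (isLowerSet_Av _)]
  have hjoin : ∀ (σ τ : Permutation) N,
      Joins (avoiders B) (entries σ.1) σ.1.length (entries τ.1) τ.1.length N →
      ∃ ρ ∈ Av {β | β ∈ B}, ρ.1.length = N ∧ σ ≤ ρ ∧ τ ≤ ρ := by
    rintro σ τ N ⟨h, hh, h₁, h₂⟩
    obtain ⟨ρ, hρ, hρN, hs⟩ := exists_mem_Av hh
    refine ⟨ρ, hρ, hρN, le_iff_embeds.2 ?_, le_iff_embeds.2 ?_⟩ <;> rw [hρN]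
    · exact h₁.congr (SameOrder.refl _ _) hs.symm
    · exact h₂.congr (SameOrder.refl _ _) hs.symm
  constructor
  · intro h σ hσ hσn τ hτ hτn
    obtain ⟨ρ, hρ, h₁, h₂⟩ := h σ hσ τ hτ
    obtain ⟨N, hN, hj⟩ := Joins.exists_short hC
      ⟨entries ρ.1, mem_Av_iff.1 hρ, le_iff_embeds.1 h₁, le_iff_embeds.1 h₂⟩
    obtain ⟨ρ', hρ', rfl, h₃⟩ := hjoin σ τ N hj
    refine ⟨ρ', hρ', ?_, h₃⟩
    simp only [splitLength] at hσn hτn ⊢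
    omega
  · intro h σ hσ τ hτ
    obtain ⟨N, hj⟩ := joins_of_short hC (fun f n g k hn hk hf hg => by
      obtain ⟨σ, hσ, rfl, hσs⟩ := exists_mem_Av hf
      obtain ⟨τ, hτ, rfl, hτs⟩ := exists_mem_Av hg
      obtain ⟨ρ, hρ, -, h₁, h₂⟩ := h σ hσ hn τ hτ hk
      exact ⟨ρ.1.length, entries ρ.1, mem_Av_iff.1 hρ,
        (le_iff_embeds.1 h₁).congr hσs.symm (SameOrder.refl _ _),
        (le_iff_embeds.1 h₂).congr hτs.symm (SameOrder.refl _ _)⟩)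
      (mem_Av_iff.1 hσ) (mem_Av_iff.1 hτ)
    obtain ⟨ρ, hρ, -, h₁⟩ := hjoin σ τ N hj
    exact ⟨ρ, hρ, h₁⟩

end ConsecPerm

/-! ### Primitive recursive predicates -/

namespace PrimrecPred

variable {α β : Type*} [Primcodable α] [Primcodable β]

theorem imp {p q : α → Prop} (hp : PrimrecPred p) (hq : PrimrecPred q) :
    PrimrecPred fun a => p a → q a :=
  (hp.not.or hq).of_eq fun _ => imp_iff_not_or.symm

theorem iff {p q : α → Prop} (hp : PrimrecPred p) (hq : PrimrecPred q) :
    PrimrecPred fun a => (p a ↔ q a) :=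
  ((hp.imp hq).and (hq.imp hp)).of_eq fun _ => iff_def.symm

theorem ball_mem {l : α → List β} {P : α → β → Prop} (hl : Primrec l)
    (hP : PrimrecPred fun x : α × β => P x.1 x.2) : PrimrecPred fun a => ∀ i ∈ l a, P a i :=
  (PrimrecRel.forall_mem_list (R := fun i a => P a i)
    (hP.comp (Primrec.snd.pair Primrec.fst))).comp hl Primrec.id

theorem bex_mem {l : α → List β} {P : α → β → Prop} (hl : Primrec l)
    (hP : PrimrecPred fun x : α × β => P x.1 x.2) : PrimrecPred fun a => ∃ i ∈ l a, P a i :=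
  (PrimrecRel.exists_mem_list (R := fun i a => P a i)
    (hP.comp (Primrec.snd.pair Primrec.fst))).comp hl Primrec.id

theorem ball_lt {n : α → ℕ} {P : α → ℕ → Prop} (hn : Primrec n)
    (hP : PrimrecPred fun x : α × ℕ => P x.1 x.2) : PrimrecPred fun a => ∀ i < n a, P a i :=
  (ball_mem (Primrec.list_range.comp hn) hP).of_eq fun _ => by simp only [List.mem_range]

theorem bex_lt {n : α → ℕ} {P : α → ℕ → Prop} (hn : Primrec n)
    (hP : PrimrecPred fun x : α × ℕ => P x.1 x.2) : PrimrecPred fun a => ∃ i < n a, P a i :=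
  (bex_mem (Primrec.list_range.comp hn) hP).of_eq fun _ => by simp only [List.mem_range]

end PrimrecPred

theorem Primrec.pow_const_base (c : ℕ) : Primrec fun n : ℕ => c ^ n :=
  (Primrec.nat_rec₁ 1 (f := fun _ y => y * c)
    (Primrec.nat_mul.comp Primrec.snd (Primrec.const c)).to₂).of_eq fun n => by
    induction n with
    | zero => rfl
    | succ n ih => rw [pow_succ, ← ih]

namespace ConsecPerm

section

variable {α : Type*} [Primcodable α] {B : α → List Permutation} {l l' : α → List ℕ}
  {i j n k : α → ℕ}

theorem primrecPred_entries_lt (hl : Primrec l) (hi : Primrec i) (hl' : Primrec l')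
    (hj : Primrec j) : PrimrecPred fun a => entries (l a) (i a) < entries (l' a) (j a) :=
  (Primrec.nat_lt.comp ((Primrec.list_getD 0).comp hl hi) ((Primrec.list_getD 0).comp hl' hj)).of_eq
    fun _ => entries_lt.symm

theorem primrecPred_sameOrder (hl : Primrec l) (hi : Primrec i) (hl' : Primrec l')
    (hj : Primrec j) (hn : Primrec n) :
    PrimrecPred fun a => SameOrder (shift (i a) (entries (l a))) (shift (j a) (entries (l' a)))
      (n a) := by
  have h₁ : Primrec fun x : (α × ℕ) × ℕ => x.1.1 := Primrec.fst.comp Primrec.fst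
  have h₂ : Primrec fun x : (α × ℕ) × ℕ => x.1.2 := Primrec.snd.comp Primrec.fst
  have h₃ : Primrec fun x : (α × ℕ) × ℕ => x.2 := Primrec.snd
  exact PrimrecPred.ball_lt hn (PrimrecPred.ball_lt (hn.comp Primrec.fst)
    ((primrecPred_entries_lt (hl.comp h₁) (Primrec.nat_add.comp (hi.comp h₁) h₂) (hl.comp h₁)
      (Primrec.nat_add.comp (hi.comp h₁) h₃)).iff
    (primrecPred_entries_lt (hl'.comp h₁) (Primrec.nat_add.comp (hj.comp h₁) h₂) (hl'.comp h₁)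
      (Primrec.nat_add.comp (hj.comp h₁) h₃))))

theorem primrecPred_sameLocal (hk : Primrec k) (hl : Primrec l) (hl' : Primrec l')
    (hn : Primrec n) :
    PrimrecPred fun a => SameLocal (k a) (entries (l a)) (entries (l' a)) (n a) := by
  have h₁ : Primrec fun x : (α × ℕ) × ℕ => x.1.1 := Primrec.fst.comp Primrec.fst
  have h₂ : Primrec fun x : (α × ℕ) × ℕ => x.1.2 := Primrec.snd.comp Primrec.fst
  have h₃ : Primrec fun x : (α × ℕ) × ℕ => x.2 := Primrec.snd
  exact PrimrecPred.ball_lt hn (PrimrecPred.ball_lt (hn.comp Primrec.fst)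
    ((Primrec.nat_lt.comp h₂ (Primrec.nat_add.comp h₃ (hk.comp h₁))).imp
    ((Primrec.nat_lt.comp h₃ (Primrec.nat_add.comp h₂ (hk.comp h₁))).imp
    ((primrecPred_entries_lt (hl.comp h₁) h₂ (hl.comp h₁) h₃).iff
    (primrecPred_entries_lt (hl'.comp h₁) h₂ (hl'.comp h₁) h₃)))))

theorem primrecPred_embeds (hl : Primrec l) (hl' : Primrec l') :
    PrimrecPred fun a => Embeds (entries (l a)) (l a).length (entries (l' a)) (l' a).length := by
  have hn := Primrec.list_length.comp (hl.comp (Primrec.fst (α := α) (β := ℕ)))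
  have hk := Primrec.list_length.comp (hl'.comp (Primrec.fst (α := α) (β := ℕ)))
  refine (PrimrecPred.bex_lt (Primrec.succ.comp (Primrec.list_length.comp hl'))
    (P := fun a o => o + (l a).length ≤ (l' a).length ∧
      SameOrder (shift 0 (entries (l a))) (shift o (entries (l' a))) (l a).length)
    ((Primrec.nat_le.comp (Primrec.nat_add.comp Primrec.snd hn) hk).and
    (primrecPred_sameOrder (hl.comp Primrec.fst) (Primrec.const 0) (hl'.comp Primrec.fst)
      Primrec.snd hn))).of_eq fun a => ?_
  simp only [shift_zero]
  exact ⟨fun ⟨o, _, h⟩ => ⟨o, h⟩, fun ⟨o, h⟩ => ⟨o, by have := h.1; omega, h⟩⟩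

theorem primrecPred_isolatedPeriod (hk : Primrec k) (hi : Primrec i) (hj : Primrec j)
    (hl : Primrec l) :
    PrimrecPred fun a => IsolatedPeriod (k a) (i a) (j a) (entries (l a)) := by
  have hsame : ∀ {γ : Type _} [Primcodable γ] {c : γ → α} {s t : γ → ℕ}, Primrec c → Primrec s →
      Primrec t → PrimrecPred fun x => SameWindow (k (c x)) (entries (l (c x))) (s x)
        (entries (l (c x))) (t x) := fun hc hs ht =>
    primrecPred_sameOrder (hl.comp hc) hs (hl.comp hc) ht (hk.comp hc)
  refine ((Primrec.nat_le.comp (Primrec.const 1) hi).and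
    ((Primrec.nat_le.comp (Primrec.const 1) hj).and
    ((PrimrecPred.ball_lt (Primrec.succ.comp hj)
      (P := fun a s => 1 ≤ s → SameWindow (k a) (entries (l a)) s (entries (l a)) (s + i a))
      ((Primrec.nat_le.comp (Primrec.const 1) Primrec.snd).imp
      (hsame Primrec.fst Primrec.snd (Primrec.nat_add.comp Primrec.snd
        (hi.comp Primrec.fst))))).and
    ((hsame Primrec.id (Primrec.const 0) hi).not.and
    (hsame Primrec.id (Primrec.succ.comp hj)
      (Primrec.nat_add.comp (Primrec.succ.comp hj) hi)).not)))).of_eq fun a => ?_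
  constructor
  · rintro ⟨h₁, h₂, h₃, h₄, h₅⟩
    exact ⟨h₁, h₂, fun s hs hs' => h₃ s (Nat.lt_succ_of_le hs') hs, h₄, h₅⟩
  · rintro ⟨h₁, h₂, h₃, h₄, h₅⟩
    exact ⟨h₁, h₂, fun s hs' hs => h₃ s hs (Nat.le_of_lt_succ hs'), h₄, h₅⟩

theorem primrec_permutation_val : Primrec fun σ : Permutation => σ.1 :=
  @Primrec.subtype_val _ _ _ (Classical.decPred _) isPermutation_primrec

theorem primrec_boundedLists : Primrec₂ boundedLists :=
  Primrec.nat_rec (f := fun _ : ℕ => [([] : List ℕ)])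
    (g := fun n (x : ℕ × List (List ℕ)) => [] :: x.2.flatMap fun l =>
      (List.range (n + 1)).map fun a => a :: l)
    (Primrec.const _)
    (Primrec.list_cons.comp (Primrec.const [])
      (Primrec.list_flatMap (Primrec.snd.comp Primrec.snd)
        (Primrec.list_map (Primrec.list_range.comp
            (Primrec.succ.comp (Primrec.fst.comp Primrec.fst)))
          (Primrec.list_cons.comp Primrec.snd (Primrec.snd.comp Primrec.fst)).to₂).to₂)).to₂

theorem primrec_windowLength : Primrec windowLength :=
  Primrec.succ.comp (Primrec.list_length.comp (Primrec.list_flatten.comp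
    (Primrec.list_map Primrec.id (primrec_permutation_val.comp Primrec.snd).to₂)))

theorem primrec_splitLength : Primrec splitLength := by
  have h : Primrec fun b : ℕ => b + 2 := Primrec.succ.comp Primrec.succ
  exact Primrec.succ.comp (Primrec.nat_add.comp
    ((Primrec.pow_const_base 4).comp (Primrec.nat_mul.comp h h)) Primrec.id)

/-- A search through the members of bounded length of an avoidance set is primitive recursive. -/
theorem primrecPred_exists_mem_Av {P : α → List ℕ → Prop} (hB : Primrec B) (hk : Primrec k)
    (hP : PrimrecPred fun x : α × List ℕ => P x.1 x.2) :
    PrimrecPred fun a => ∃ σ ∈ Av {β | β ∈ B a}, σ.1.length ≤ k a ∧ P a σ.1 := by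
  refine (PrimrecPred.bex_mem (primrec_boundedLists.comp hk hk)
    (P := fun a l => IsPermutation l ∧ (∀ β ∈ B a,
      ¬ Embeds (entries β.1) β.1.length (entries l) l.length) ∧ l.length ≤ k a ∧ P a l)
    ((isPermutation_primrec.comp Primrec.snd).and
      ((PrimrecPred.ball_mem (hB.comp Primrec.fst)
        (primrecPred_embeds (primrec_permutation_val.comp Primrec.snd)
          (Primrec.snd.comp Primrec.fst)).not).and
      ((Primrec.nat_le.comp (Primrec.list_length.comp Primrec.snd) (hk.comp Primrec.fst)).and
        hP)))).of_eq fun a => ?_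
  constructor
  · rintro ⟨l, -, hl, hlB, hlk, h⟩
    exact ⟨⟨l, hl⟩, mem_Av_iff.2 ⟨hl.inj, hlB⟩, hlk, h⟩
  · rintro ⟨σ, hσ, hσk, h⟩
    exact ⟨σ.1, σ.mem_boundedLists hσk, σ.2, (mem_Av_iff.1 hσ).2, hσk, h⟩

theorem primrecPred_forall_mem_Av {P : α → List ℕ → Prop} (hB : Primrec B) (hk : Primrec k)
    (hP : PrimrecPred fun x : α × List ℕ => P x.1 x.2) :
    PrimrecPred fun a => ∀ σ ∈ Av {β | β ∈ B a}, σ.1.length ≤ k a → P a σ.1 :=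
  (primrecPred_exists_mem_Av (P := fun a l => ¬ P a l) hB hk hP.not).not.of_eq fun a => by
    push Not
    rfl

end

/-! ### The decision procedures -/

theorem primrecPred_atomic_Av :
    PrimrecPred fun B : List Permutation => Atomic (Av {β | β ∈ B}) := by
  have hS := primrec_splitLength.comp primrec_windowLength
  have hK := Primrec.nat_mul.comp (Primrec.const 8) hS
  have hK' := Primrec.nat_mul.comp (Primrec.const 17) hS
  have hB : Primrec fun x : (List Permutation × List ℕ) × List ℕ => x.1.1 :=
    Primrec.fst.comp Primrec.fst
  refine (primrecPred_forall_mem_Av Primrec.id hK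
    (P := fun B l => ∀ τ ∈ Av {β | β ∈ B}, τ.1.length ≤ 8 * splitLength (windowLength B) →
      ∃ ρ ∈ Av {β | β ∈ B}, ρ.1.length ≤ 17 * splitLength (windowLength B) ∧
        Embeds (entries l) l.length (entries ρ.1) ρ.1.length ∧
        Embeds (entries τ.1) τ.1.length (entries ρ.1) ρ.1.length)
    (primrecPred_forall_mem_Av Primrec.fst (hK.comp Primrec.fst)
      (P := fun x l' => ∃ ρ ∈ Av {β | β ∈ x.1},
        ρ.1.length ≤ 17 * splitLength (windowLength x.1) ∧
        Embeds (entries x.2) x.2.length (entries ρ.1) ρ.1.length ∧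
        Embeds (entries l') l'.length (entries ρ.1) ρ.1.length)
      (primrecPred_exists_mem_Av hB (hK'.comp hB)
        (P := fun x h => Embeds (entries x.1.2) x.1.2.length (entries h) h.length ∧
          Embeds (entries x.2) x.2.length (entries h) h.length)
        ((primrecPred_embeds (Primrec.snd.comp (Primrec.fst.comp Primrec.fst)) Primrec.snd).and
          (primrecPred_embeds (Primrec.snd.comp Primrec.fst) Primrec.snd))))).of_eq fun B => ?_
  simp only [atomic_Av_iff, le_iff_embeds, id]

theorem IsolatedPeriod.congr {M p r : ℕ} {f g : ℕ → ℚ} (h : IsolatedPeriod M p r f)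
    (hfg : SameOrder f g (p + r + 1 + M)) : IsolatedPeriod M p r g := by
  have hW : ∀ i ≤ p + r + 1, SameWindow M f i g i := fun i hi => hfg.shift (by omega)
  refine ⟨h.period_pos, h.pos, fun i hi hir => ?_, fun hc => h.left ?_, fun hc => h.right ?_⟩
  · exact (hW i (by omega)).symm.trans ((h.same i hi hir).trans (hW (i + p) (by omega)))
  · exact (hW 0 (by omega)).trans (hc.trans (hW p (by omega)).symm)
  · exact (hW (r + 1) (by omega)).trans (hc.trans (hW (r + 1 + p) (by omega)).symm)

theorem exists_splitPair_iff (B : List Permutation) (b l : ℕ) :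
    (∃ f g, SplitPair (avoiders B) b l f g) ↔
      ∃ σ ∈ Av {β | β ∈ B}, σ.1.length ≤ l + 1 ∧ ∃ τ ∈ Av {β | β ∈ B}, τ.1.length ≤ l + 1 ∧
        σ.1.length = l + 1 ∧ τ.1.length = l + 1 ∧
        SameLocal b (entries σ.1) (entries τ.1) (l + 1) ∧
        entries σ.1 0 < entries σ.1 l ∧ entries τ.1 l < entries τ.1 0 := by
  constructor
  · rintro ⟨f, g, h⟩
    obtain ⟨σ, hσ, hσl, hσf⟩ := exists_mem_Av h.left
    obtain ⟨τ, hτ, hτl, hτg⟩ := exists_mem_Av h.right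
    refine ⟨σ, hσ, hσl.le, τ, hτ, hτl.le, hσl, hτl, fun i hi j hj h₁ h₂ => ?_, ?_, ?_⟩
    · rw [hσf i hi j hj, hτg i hi j hj, h.same i hi j hj h₁ h₂]
    · rw [hσf 0 (by omega) l (by omega)]
      exact h.lt
    · rw [hτg l (by omega) 0 (by omega)]
      exact h.gt
  · rintro ⟨σ, hσ, -, τ, hτ, -, hσl, hτl, h₁, h₂, h₃⟩
    have hσ' := mem_Av_iff.1 hσ
    have hτ' := mem_Av_iff.1 hτ
    rw [hσl] at hσ'
    rw [hτl] at hτ'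
    exact ⟨_, _, hσ', hτ', h₁, h₂, h₃⟩

theorem exists_isolatedPeriod_iff (B : List Permutation) (m p r : ℕ) :
    (∃ f, avoiders B f (p + r + 1 + m) ∧ IsolatedPeriod m p r f) ↔
      ∃ σ ∈ Av {β | β ∈ B}, σ.1.length ≤ p + r + 1 + m ∧
        σ.1.length = p + r + 1 + m ∧ IsolatedPeriod m p r (entries σ.1) := by
  constructor
  · rintro ⟨f, hf, h⟩
    obtain ⟨σ, hσ, hσl, hσf⟩ := exists_mem_Av hf
    exact ⟨σ, hσ, hσl.le, hσl, h.congr hσf.symm⟩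
  · rintro ⟨σ, hσ, -, hσl, h⟩
    have hσ' := mem_Av_iff.1 hσ
    rw [hσl] at hσ'
    exact ⟨_, hσ', h⟩

theorem primrecPred_hasObstruction : PrimrecPred fun B : List Permutation =>
    HasObstruction (avoiders B) (windowLength B) (splitLength (windowLength B)) := by
  have hb := primrec_windowLength
  have hm := primrec_splitLength.comp hb
  have hsplit : PrimrecPred fun B : List Permutation =>
      ∃ l < 2 * splitLength (windowLength B), splitLength (windowLength B) ≤ l ∧
        ∃ f g, SplitPair (avoiders B) (windowLength B) l f g := by
    refine PrimrecPred.bex_lt (Primrec.nat_mul.comp (Primrec.const 2) hm)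
      ((Primrec.nat_le.comp (hm.comp Primrec.fst) Primrec.snd).and
        (PrimrecPred.of_eq ?_ fun x => (exists_splitPair_iff x.1 (windowLength x.1) x.2).symm))
    have hB : Primrec fun x : ((List Permutation × ℕ) × List ℕ) × List ℕ => x.1.1.1 :=
      Primrec.fst.comp (Primrec.fst.comp Primrec.fst)
    have hl : Primrec fun x : ((List Permutation × ℕ) × List ℕ) × List ℕ => x.1.1.2 :=
      Primrec.snd.comp (Primrec.fst.comp Primrec.fst)
    have hs : Primrec fun x : ((List Permutation × ℕ) × List ℕ) × List ℕ => x.1.2 :=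
      Primrec.snd.comp Primrec.fst
    have ht : Primrec fun x : ((List Permutation × ℕ) × List ℕ) × List ℕ => x.2 := Primrec.snd
    have hl' := Primrec.succ.comp hl
    have h0 : Primrec fun _ : ((List Permutation × ℕ) × List ℕ) × List ℕ => 0 := Primrec.const 0
    have hS : Primrec fun x : List Permutation × ℕ => x.2 + 1 := Primrec.succ.comp Primrec.snd
    exact primrecPred_exists_mem_Av Primrec.fst hS
      (P := fun x s => ∃ τ ∈ Av {β | β ∈ x.1}, τ.1.length ≤ x.2 + 1 ∧
        s.length = x.2 + 1 ∧ τ.1.length = x.2 + 1 ∧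
        SameLocal (windowLength x.1) (entries s) (entries τ.1) (x.2 + 1) ∧
        entries s 0 < entries s x.2 ∧ entries τ.1 x.2 < entries τ.1 0)
      (primrecPred_exists_mem_Av (Primrec.fst.comp Primrec.fst) (hS.comp Primrec.fst)
        (P := fun x t => x.2.length = x.1.2 + 1 ∧ t.length = x.1.2 + 1 ∧
          SameLocal (windowLength x.1.1) (entries x.2) (entries t) (x.1.2 + 1) ∧
          entries x.2 0 < entries x.2 x.1.2 ∧ entries t x.1.2 < entries t 0)
        ((Primrec.eq.comp (Primrec.list_length.comp hs) hl').and
        ((Primrec.eq.comp (Primrec.list_length.comp ht) hl').and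
        ((primrecPred_sameLocal (hb.comp hB) hs ht hl').and
        ((primrecPred_entries_lt hs h0 hs hl).and (primrecPred_entries_lt ht hl ht h0))))))
  have hperiod : PrimrecPred fun B : List Permutation =>
      ∃ p < 4 ^ (splitLength (windowLength B) * splitLength (windowLength B)) + 1, ∃ r < p + 1,
        ∃ f, avoiders B f (p + r + 1 + splitLength (windowLength B)) ∧
          IsolatedPeriod (splitLength (windowLength B)) p r f := by
    refine PrimrecPred.bex_lt (Primrec.succ.comp ((Primrec.pow_const_base 4).comp
      (Primrec.nat_mul.comp hm hm))) (PrimrecPred.bex_lt (Primrec.succ.comp Primrec.snd)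
      (PrimrecPred.of_eq ?_ fun x => (exists_isolatedPeriod_iff x.1.1
        (splitLength (windowLength x.1.1)) x.1.2 x.2).symm))
    have hB : Primrec fun x : (List Permutation × ℕ) × ℕ => x.1.1 := Primrec.fst.comp Primrec.fst
    have hp : Primrec fun x : (List Permutation × ℕ) × ℕ => x.1.2 := Primrec.snd.comp Primrec.fst
    have hN : Primrec fun x : (List Permutation × ℕ) × ℕ =>
        x.1.2 + x.2 + 1 + splitLength (windowLength x.1.1) :=
      Primrec.nat_add.comp (Primrec.succ.comp (Primrec.nat_add.comp hp Primrec.snd))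
        (hm.comp hB)
    exact primrecPred_exists_mem_Av hB hN
      (P := fun x s => s.length = x.1.2 + x.2 + 1 + splitLength (windowLength x.1.1) ∧
        IsolatedPeriod (splitLength (windowLength x.1.1)) x.1.2 x.2 (entries s))
      ((Primrec.eq.comp (Primrec.list_length.comp Primrec.snd) (hN.comp Primrec.fst)).and
        (primrecPred_isolatedPeriod (hm.comp (hB.comp Primrec.fst)) (hp.comp Primrec.fst)
          (Primrec.snd.comp Primrec.fst) Primrec.snd))
  exact hsplit.or hperiod

end ConsecPerm

/-- The input is a finite list of permutations, presented as the lists of their entries. -/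
theorem theorem1p2 :
    ComputablePred (fun B : List ConsecPerm.Permutation =>
      ConsecPerm.Atomic (ConsecPerm.Av {β | β ∈ B})) ∧
    ComputablePred (fun B : List ConsecPerm.Permutation =>
      ConsecPerm.WQO (ConsecPerm.Av {β | β ∈ B})) :=
  ⟨ConsecPerm.primrecPred_atomic_Av.computablePred,
    (ConsecPerm.primrecPred_hasObstruction.not.of_eq fun B =>
      (ConsecPerm.wqo_Av_iff B).symm).computablePred⟩
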